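/- Let $S_h=\frac{\sqrt2}{\sqrt[4]{3}}\begin{pmatrix}1&\frac12\\0&\frac{\sqrt3}{2}\end{pmatrix}\in SL(2,\mathbb R)$ and let $\Lambda_h=S_h\mathbb Z^2$ be the hexagonal lattice of area $1$. In the coordinates $z=(x,y)\in\mathbb R^2/\mathbb Z^2$ of the lattice basis (so $z$ stands for the point $S_hz$ of $\mathbb R^2/\Lambda_h$), and with time rescaled by $4\pi$, the heat kernel of the flat torus $\mathbb R^2/\Lambda_h$ at time $t=1$ is $$p_{\Lambda_h}(z;1)=\sum_{(k,l)\in\mathbb Z^2}e^{-\frac{2\pi}{\sqrt3}(k^2+kl+l^2)}e^{2\pi i(ky-lx)}.$$ Put $A_{\Lambda_h}(1)=\min_z p_{\Lambda_h}(z;1)$ and $B_{\Lambda_h}(1)=\max_z p_{\Lambda_h}(z;1)$, and for $0<q<1$ let $$a(q)=\sum_{(k,l)\in\mathbb Z^2}q^{k^2+kl+l^2},\qquad b(q)=\sum_{(k,l)\in\mathbb Z^2}q^{k^2+kl+l^2}e^{2\pi i\left(\frac k3-\frac l3\right)}.$$ Let $\mathcal L_+=\dfrac{\Gamma(1/3)\,\Gamma(5/6)}{\Gamma(1/6)}$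 be Rademacher's upper bound for Landau's constant. Then: 1. For every $z$ the series defining $p_{\Lambda_h}(z;1)$ converges absolutely, its value is real, and $p_{\Lambda_h}(z;1)=\sum_{\lambda\in\mathbb Z^2}e^{-\pi|S_h(\lambda+z)|^2}$. 2. The minimum and the maximum exist, the minimum is attained at $z=(\frac13,\frac13)$ and the maximum at $z=0$, and $$A_{\Lambda_h}(1)=p_{\Lambda_h}\big((\tfrac13,\tfrac13);1\big)=b\big(e^{-2\pi/\sqrt3}\big),\qquad B_{\Lambda_h}(1)=p_{\Lambda_h}(0;1)=a\big(e^{-2\pi/\sqrt3}\big).$$ 3. $\dfrac{A_{\Lambda_h}(1)}{B_{\Lambda_h}(1)}=2^{-1/3}$. 4. $$2A_{\Lambda_h}(1)=2^{2/3}\,{}_2F_1\big(\tfrac13,\tfrac23;1;\tfrac12\big)=\frac{\Gamma(1/6)}{\Gamma(1/3)\,\Gamma(5/6)}=\mathcal L_+^{-1}.$$ -/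

import Mathlib

noncomputable section

/-- The standard symplectic form `σ((k, l), (x, y)) = k y - l x` on `ℝ²`. -/
def symplecticForm (v w : Fin 2 → ℝ) : ℝ := v 0 * w 1 - w 0 * v 1

/-- An integer vector, seen as a real vector. -/
def intVec (n : ℤ × ℤ) : Fin 2 → ℝ := ![(n.1 : ℝ), (n.2 : ℝ)]

/-- The square of the Euclidean length of `S v`, that is `vᵀ Sᵀ S v`. -/
def sqLength (S : Matrix.SpecialLinearGroup (Fin 2) ℝ) (v : Fin 2 → ℝ) : ℝ :=
  (S.val.mulVec v) ⬝ᵥ (S.val.mulVec v)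

/-- The term of index `n` in the eigenfunction expansion of the heat kernel. -/
def heatTerm (S : Matrix.SpecialLinearGroup (Fin 2) ℝ) (t : ℝ) (z : Fin 2 → ℝ)
    (n : ℤ × ℤ) : ℂ :=
  Complex.exp (-(Real.pi * t * sqLength S (intVec n) : ℝ)) *
    Complex.exp (2 * Real.pi * Complex.I * (symplecticForm (intVec n) z : ℝ))

/-- The heat kernel (one point at the origin, time rescaled by `4π`) of the flat torus `ℝ² / S ℤ²`
of area one. The point `z` is given in the coordinates of the lattice basis, so it stands for the
point `S z` of the plane, and the kernel is `ℤ²`-periodic in `z`. -/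
def heatKernel (S : Matrix.SpecialLinearGroup (Fin 2) ℝ) (t : ℝ) (z : Fin 2 → ℝ) : ℂ :=
  ∑' n : ℤ × ℤ, heatTerm S t z n

/-- The lowest temperature `A_Λ(t)` on the torus of the lattice `Λ = S ℤ²`. -/
def minTemperature (S : Matrix.SpecialLinearGroup (Fin 2) ℝ) (t : ℝ) : ℝ :=
  ⨅ z : Fin 2 → ℝ, (heatKernel S t z).re

/-- The highest temperature `B_Λ(t)` on the torus of the lattice `Λ = S ℤ²`. -/
def maxTemperature (S : Matrix.SpecialLinearGroup (Fin 2) ℝ) (t : ℝ) : ℝ :=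
  ⨆ z : Fin 2 → ℝ, (heatKernel S t z).re

/-- The generating matrix of the hexagonal lattice of area one, `√2 / 3^(1/4)` times the matrix with
columns `(1, 0)` and `(1/2, √3/2)`. -/
def hexMatrix : Matrix (Fin 2) (Fin 2) ℝ :=
  (Real.sqrt 2 / (3 : ℝ) ^ ((1 : ℝ) / 4)) • !![1, 1 / 2; 0, Real.sqrt 3 / 2]

theorem hexMatrix_det : hexMatrix.det = 1 := by
  have h3 : ((3 : ℝ) ^ ((1 : ℝ) / 4)) ^ 2 = Real.sqrt 3 := by
    rw [← Real.rpow_natCast, ← Real.rpow_mul (by norm_num), Real.sqrt_eq_rpow]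
    norm_num
  have h2 : Real.sqrt 2 ^ 2 = 2 := Real.sq_sqrt (by norm_num)
  have h0 : Real.sqrt 3 ≠ 0 := by positivity
  rw [hexMatrix, Matrix.det_smul, Matrix.det_fin_two_of, Fintype.card_fin, div_pow, h2, h3]
  field_simp
  ring

/-- The hexagonal lattice of area one, through its generating matrix. -/
def hexLattice : Matrix.SpecialLinearGroup (Fin 2) ℝ := ⟨hexMatrix, hexMatrix_det⟩

/-- The cubic theta function `a(q)`. -/
def cubicThetaA (q : ℝ) : ℝ :=
  ∑' n : ℤ × ℤ, q ^ (n.1 ^ 2 + n.1 * n.2 + n.2 ^ 2)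

/-- The cubic theta function `b(q)`. -/
def cubicThetaB (q : ℝ) : ℂ :=
  ∑' n : ℤ × ℤ, (q : ℂ) ^ (n.1 ^ 2 + n.1 * n.2 + n.2 ^ 2) *
    Complex.exp (2 * Real.pi * Complex.I * ((n.1 : ℂ) / 3 - (n.2 : ℂ) / 3))

/-- Rademacher's upper bound for Landau's constant. -/
def rademacherBound : ℝ :=
  Real.Gamma (1 / 3) * Real.Gamma (5 / 6) / Real.Gamma (1 / 6)

end

/-! Write N = k² + kl + l² and q = exp(-2π/√3), and let a be the sum of q^N. Poisson summation
carries the character series to a periodized Gaussian of the same form N, because the lattice has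
area one. The kernel is therefore real. It is largest at the origin, where every cosine equals 1.

For the minimum, compare a point with (1/3, 1/3) and group the characters into orbits of the
rotation by 2π/3. The three characters of an orbit have product 1, so their total change is
quadratic in the distance to (1/3, 1/3), at most 12 N H with H the squared distance of the phases.
The six shortest vectors contribute exactly g/2 each, where g = 3 + 2 cos α + 2 cos β + 2 cos(α +
β). The inequality H ≤ 10 g holds for (1/3, 1/3) or for its mirror image (`hexTrig_le`), and the
other shells are light enough to be absorbed (`summable_and_tsum_hexNorm_mul_le`).

The ratio comes from the cubic identity a³ = b³ + c³. Splitting triples of Eisenstein integers by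
their sum modulo √-3, and applying a discrete Fourier transform of order 3, proves it
(`hexTripleSum_one_eq`). At this q, Poisson summation gives b = c, hence a³ = 2b³.

The value of a comes from a = θ₃(t)θ₃(3t) + θ₂(t)θ₂(3t) at t = 2/√3. Duplication and inversion
reduce everything to t = √3, where the cubic modular equation fixes θ₄/θ₃
(`thetaFour_sqrt_three_pow_four`). Landen's transformation then gives θ₃² as an elliptic integral
(`agmIntegral_theta`), which a substitution makes a beta integral (`integral_quartic_eq_beta`). The
hypergeometric value is computed separately from Euler's integral, and the two meet in the same
Gamma quotient. -/

section

/-! ### Poisson summation for the hexagonal lattice. -/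

open Real Complex in
theorem summable_exp_neg_mul_add_sq {c : ℝ} (hc : 0 < c) (x : ℝ) :
    Summable fun n : ℤ => Real.exp (-(π * c * ((n : ℝ) + x) ^ 2)) := by
  have h : Summable fun n : ℤ => Real.exp (-(π * (c / 2) * (n : ℝ) ^ 2)) := by
    have h1 : 0 < (((c / 2 : ℝ) : ℂ) * I).im := by simpa using hc
    refine ((summable_jacobiTheta₂_term_iff 0 _).2 h1).norm.congr fun n => ?_
    rw [jacobiTheta₂_term, Complex.norm_exp]
    congr 1
    have : 2 * π * I * (n : ℂ) * 0 + (π * I * (n : ℂ) ^ 2 * (((c / 2 : ℝ) : ℂ) * I)) =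
      ((-(π * (c / 2) * (n : ℝ) ^ 2) : ℝ) : ℂ) := by
      push_cast
      linear_combination (π * (n : ℂ) ^ 2 * (c / 2)) * I_sq
    rw [this, ofReal_re]
  refine (h.mul_left (Real.exp (π * c * x ^ 2))).of_nonneg_of_le (fun _ => (Real.exp_pos _).le)
    fun n => ?_
  rw [← Real.exp_add]
  refine Real.exp_le_exp.2 ?_
  have := mul_nonneg (mul_pos pi_pos hc).le (sq_nonneg ((n : ℝ) + 2 * x))
  linarith

/-- The Gaussian of the hexagonal lattice of area one, in lattice coordinates. -/
noncomputable def hexGaussian (x y : ℝ) : ℝ :=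
  Real.exp (-(Real.pi * (2 / √3) * (x ^ 2 + x * y + y ^ 2)))

theorem hexGaussian_pos (x y : ℝ) : 0 < hexGaussian x y := Real.exp_pos _

open Real in
theorem summable_hexForm {c : ℝ} (hc : 0 < c) (x y : ℝ) :
    Summable fun n : ℤ × ℤ => Real.exp (-(π * c *
      (((n.1 : ℝ) + x) ^ 2 + (n.1 + x) * (n.2 + y) + ((n.2 : ℝ) + y) ^ 2))) := by
  have h := (summable_exp_neg_mul_add_sq (half_pos hc) x).mul_of_nonneg
    (summable_exp_neg_mul_add_sq (half_pos hc) y) (fun _ => (Real.exp_pos _).le)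
    (fun _ => (Real.exp_pos _).le)
  refine h.of_nonneg_of_le (fun _ => (Real.exp_pos _).le) fun n => ?_
  rw [← Real.exp_add]
  refine Real.exp_le_exp.2 ?_
  have := mul_nonneg (mul_pos pi_pos hc).le (sq_nonneg ((n.1 : ℝ) + x + (n.2 + y)))
  linarith

theorem summable_hexGaussian (x y : ℝ) :
    Summable fun n : ℤ × ℤ => hexGaussian ((n.1 : ℝ) + x) (n.2 + y) :=
  summable_hexForm (by positivity) x y

theorem summable_hexGaussian_int :
    Summable fun n : ℤ × ℤ => hexGaussian (n.1 : ℝ) n.2 := by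
  simpa using summable_hexGaussian 0 0

-- Jacobi's transformation with a complex linear term encodes the shift α and the character x at
-- once; the two factors exp(∓πcα²) cancel.
open Real Complex in
theorem tsum_gaussian_mul_exp {c : ℝ} (hc : 0 < c) (α x : ℝ) :
    ∑' l : ℤ, cexp (-(π * c * ((l : ℂ) + α) ^ 2)) * cexp (-(2 * π * I * (l * x))) =
      ((√c)⁻¹ : ℝ) * ∑' j : ℤ, cexp (-(π / c * ((j : ℂ) + x) ^ 2)) *
        cexp (2 * π * I * (α * (j + x))) := by
  have hc' : (c : ℂ) ≠ 0 := ofReal_ne_zero.2 hc.ne'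
  have h := Complex.tsum_exp_neg_quadratic (a := (c : ℂ)) (by simpa using hc)
    (-(I * x) - c * α)
  have h1 : ∀ l : ℤ, cexp (-(π * c * ((l : ℂ) + α) ^ 2)) * cexp (-(2 * π * I * (l * x))) =
      cexp (-(π * c * α ^ 2)) *
        cexp (-π * c * (l : ℂ) ^ 2 + 2 * π * (-(I * x) - c * α) * l) := fun l => by
    rw [← Complex.exp_add, ← Complex.exp_add]
    congr 1
    ring
  have h2 : ∀ j : ℤ, cexp (-π / c * ((j : ℂ) + I * (-(I * x) - c * α)) ^ 2) =
      cexp (π * c * α ^ 2) * (cexp (-(π / c * ((j : ℂ) + x) ^ 2)) *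
        cexp (2 * π * I * (α * (j + x)))) := fun j => by
    rw [← Complex.exp_add, ← Complex.exp_add]
    congr 1
    have : ((j : ℂ) + I * (-(I * x) - c * α)) = (j + x) - I * (c * α) := by
      linear_combination (-(x : ℂ)) * I_sq
    rw [this]
    field_simp
    linear_combination (-(c : ℂ) ^ 2 * α ^ 2) * I_sq
  simp_rw [h1, tsum_mul_left, h, h2, tsum_mul_left]
  have h3 : cexp (-(π * c * α ^ 2)) * cexp (π * c * α ^ 2) = 1 := by
    rw [← Complex.exp_add]; simp
  have h4 : (1 : ℂ) / (c : ℂ) ^ (1 / 2 : ℂ) = ((√c)⁻¹ : ℝ) := by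
    rw [Real.sqrt_eq_rpow, one_div, ofReal_inv, ofReal_cpow hc.le]
    norm_num
  rw [h4]
  linear_combination (((√c)⁻¹ : ℝ) * ∑' j : ℤ, cexp (-(π / c * ((j : ℂ) + x) ^ 2)) *
        cexp (2 * π * I * (α * (j + x)))) * h3

open Real Complex in
theorem tsum_gaussian_mul_exp' {c : ℝ} (hc : 0 < c) (w : ℝ) :
    ∑' l : ℤ, cexp (-(π * c * (l : ℂ) ^ 2)) * cexp (2 * π * I * (l * w)) =
      ((√c)⁻¹ : ℝ) * ∑' j : ℤ, cexp (-(π / c * ((j : ℂ) + w) ^ 2)) := by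
  have h := tsum_gaussian_mul_exp hc 0 w
  rw [← (Equiv.neg ℤ).tsum_eq] at h
  simpa using h

theorem sqLength_hexLattice (v : Fin 2 → ℝ) :
    sqLength hexLattice v = 2 / √3 * (v 0 ^ 2 + v 0 * v 1 + v 1 ^ 2) := by
  have h3 : ((3 : ℝ) ^ ((1 : ℝ) / 4)) ^ 2 = √3 := by
    rw [← Real.rpow_natCast, ← Real.rpow_mul (by norm_num), Real.sqrt_eq_rpow]
    norm_num
  have h2 : √2 ^ 2 = (2 : ℝ) := Real.sq_sqrt (by norm_num)
  have h4 : √3 ^ 2 = (3 : ℝ) := Real.sq_sqrt (by norm_num)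
  have h : (√2 / (3 : ℝ) ^ ((1 : ℝ) / 4)) ^ 2 = 2 / √3 := by rw [div_pow, h2, h3]
  rw [← h]
  rw [sqLength, show hexLattice.val = hexMatrix from rfl, hexMatrix]
  generalize √2 / (3 : ℝ) ^ ((1 : ℝ) / 4) = r
  simp only [dotProduct, Matrix.mulVec, Fin.sum_univ_two]
  simp
  linear_combination (r ^ 2 * (v 1) ^ 2 / 4) * h4

theorem exp_sqLength_hexLattice (n : ℤ × ℤ) (z : Fin 2 → ℝ) :
    Real.exp (-Real.pi * sqLength hexLattice (intVec n + z)) =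
      hexGaussian (n.1 + z 0) (n.2 + z 1) := by
  rw [sqLength_hexLattice, hexGaussian]
  simp [intVec]
  ring

theorem heatTerm_hexLattice (z : Fin 2 → ℝ) (n : ℤ × ℤ) :
    heatTerm hexLattice 1 z n = (hexGaussian n.1 n.2 : ℝ) *
      Complex.exp ((2 * Real.pi * (n.1 * z 1 - n.2 * z 0) : ℝ) * Complex.I) := by
  rw [heatTerm, sqLength_hexLattice, hexGaussian, Complex.ofReal_exp]
  congr 2
  · simp [intVec]; ring
  · simp [intVec, symplecticForm]; ring

theorem summable_heatTerm_hexLattice (z : Fin 2 → ℝ) : Summable (heatTerm hexLattice 1 z) := by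
  refine Summable.of_norm ?_
  refine summable_hexGaussian_int.congr fun n => ?_
  rw [heatTerm_hexLattice, norm_mul, Complex.norm_exp_ofReal_mul_I, mul_one, Complex.norm_real,
    Real.norm_of_nonneg (hexGaussian_pos _ _).le]

open Real Complex in
/-- Poisson summation for the hexagonal lattice. -/
theorem heatKernel_hexLattice_eq_tsum (z : Fin 2 → ℝ) :
    heatKernel hexLattice 1 z =
      ((∑' n : ℤ × ℤ, hexGaussian (n.1 + z 0) (n.2 + z 1) : ℝ) : ℂ) := by
  set c : ℝ := 2 / √3 with hc
  set d : ℝ := √3 / 2 with hd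
  have h3 : √3 ^ 2 = (3 : ℝ) := Real.sq_sqrt (by norm_num)
  have hc0 : 0 < c := by positivity
  have hd0 : 0 < d := by positivity
  have hcd : c * d = 1 := by rw [hc, hd]; field_simp
  have hdc : d = 3 / 4 * c := by rw [hc, hd]; field_simp; linarith
  set x := z 0
  set y := z 1
  -- Completing the square: c(k² + kl + l²) = c(l + k/2)² + dk². Poisson summation is applied in l
  -- with shift k/2, and then in k.
  have e1 : ∀ k l : ℤ, heatTerm hexLattice 1 z (k, l) =
      cexp (-(π * d * (k : ℂ) ^ 2)) * cexp (2 * π * I * (k * y)) *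
       (cexp (-(π * c * ((l : ℂ) + (k / 2 : ℝ)) ^ 2)) * cexp (-(2 * π * I * (l * x)))) := by
    intro k l
    rw [heatTerm_hexLattice, hexGaussian, ← hc, ofReal_exp, hdc]
    simp only [← Complex.exp_add]
    congr 1
    push_cast
    ring
  have hs : Summable (Function.uncurry fun (k j : ℤ) =>
      cexp (-(π * d * (k : ℂ) ^ 2)) * cexp (2 * π * I * (k * y)) *
      (cexp (-(π / c * ((j : ℂ) + x) ^ 2)) * cexp (2 * π * I * ((k / 2 : ℝ) * (j + x))))) := by
    refine Summable.of_norm ?_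
    refine ((summable_exp_neg_mul_add_sq hd0 0).mul_of_nonneg
      (summable_exp_neg_mul_add_sq (inv_pos.2 hc0) x) (fun _ => (Real.exp_pos _).le)
        (fun _ => (Real.exp_pos _).le)).congr fun p => ?_
    simp only [Function.uncurry, norm_mul]
    have a1 : (-(π * d * (p.1 : ℂ) ^ 2)) = ((-(π * d * ((p.1 : ℝ) + 0) ^ 2) : ℝ) : ℂ) := by
      push_cast; ring
    have a2 : (-(π / c * ((p.2 : ℂ) + x) ^ 2)) = ((-(π * c⁻¹ * ((p.2 : ℝ) + x) ^ 2) : ℝ) : ℂ) := by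
      push_cast; ring
    have a3 : 2 * π * I * ((p.1 : ℂ) * y) = ((2 * π * (p.1 * y) : ℝ) : ℂ) * I := by
      push_cast; ring
    have a4 : 2 * π * I * (((p.1 / 2 : ℝ) : ℂ) * (p.2 + x)) =
        ((2 * π * (p.1 / 2 * (p.2 + x)) : ℝ) : ℂ) * I := by
      push_cast; ring
    rw [a1, a2, a3, a4, norm_exp_ofReal_mul_I, norm_exp_ofReal_mul_I, ← ofReal_exp, ← ofReal_exp,
      Complex.norm_real, Complex.norm_real, Real.norm_of_nonneg (Real.exp_pos _).le,
      Real.norm_of_nonneg (Real.exp_pos _).le, mul_one, mul_one]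
  -- The phase left by the shift k/2 joins the character in k, moving its argument to y + (j + x)/2.
  have e2 : ∀ j k : ℤ, cexp (-(π * d * (k : ℂ) ^ 2)) * cexp (2 * π * I * (k * y)) *
      (cexp (-(π / c * ((j : ℂ) + x) ^ 2)) * cexp (2 * π * I * ((k / 2 : ℝ) * (j + x)))) =
      cexp (-(π / c * ((j : ℂ) + x) ^ 2)) *
      (cexp (-(π * d * (k : ℂ) ^ 2)) * cexp (2 * π * I * (k * (y + (j + x) / 2 : ℝ)))) := by
    intro j k
    simp only [← Complex.exp_add]
    congr 1
    push_cast
    ring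
  -- Area one: the two Poisson factors cancel.
  have hsq : ((√c)⁻¹ : ℝ) * (√d)⁻¹ = 1 := by
    rw [← mul_inv, ← Real.sqrt_mul hc0.le, hcd]; simp
  have hsqC : (((√c)⁻¹ : ℝ) : ℂ) * ((√d)⁻¹ : ℝ) = 1 := by rw [← ofReal_mul, hsq, ofReal_one]
  rw [heatKernel, (summable_heatTerm_hexLattice z).tsum_prod]
  simp_rw [e1, tsum_mul_left, tsum_gaussian_mul_exp hc0, mul_left_comm _ (((√c)⁻¹ : ℝ) : ℂ),
    ← tsum_mul_left]
  rw [tsum_congr fun _ => tsum_mul_left, tsum_mul_left, ← hs.tsum_comm]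
  simp_rw [e2, tsum_mul_left, tsum_gaussian_mul_exp' hd0, mul_left_comm _ (((√d)⁻¹ : ℝ) : ℂ)]
  rw [tsum_mul_left, ← mul_assoc, hsqC, one_mul, (summable_hexGaussian x y).tsum_prod, ofReal_tsum]
  simp_rw [ofReal_tsum, ← tsum_mul_left]
  refine tsum_congr fun j => tsum_congr fun i => ?_
  rw [hexGaussian, ofReal_exp, ← Complex.exp_add]
  congr 1
  have : (1 : ℝ) / c = d := by field_simp; linarith
  have h1 : (π / c : ℂ) = π * (3 / 4 * c : ℝ) := by
    rw [← hdc, ← this]; push_cast; ring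
  have : (1 : ℝ) / d = c := by field_simp; linarith
  have h2 : (π / d : ℂ) = π * (c : ℝ) := by
    rw [← this]; push_cast; ring
  rw [h1, h2, ← hc]
  push_cast
  ring

end

/-! ### Weight of the norm shells. -/

section

/-- The norm form `k² + kl + l²` of the hexagonal lattice. -/
def hexNorm (n : ℤ × ℤ) : ℕ := (n.1 ^ 2 + n.1 * n.2 + n.2 ^ 2).toNat

theorem hexNorm_cast_int (n : ℤ × ℤ) : (hexNorm n : ℤ) = n.1 ^ 2 + n.1 * n.2 + n.2 ^ 2 :=
  Int.toNat_of_nonneg (by nlinarith [sq_nonneg (n.1 + n.2), sq_nonneg n.1, sq_nonneg n.2])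

theorem hexNorm_cast (n : ℤ × ℤ) :
    (hexNorm n : ℝ) = (n.1 : ℝ) ^ 2 + n.1 * n.2 + (n.2 : ℝ) ^ 2 := by
  exact_mod_cast congrArg (Int.cast : ℤ → ℝ) (hexNorm_cast_int n)

/-- The self-dual nome `exp (-2π / √3)`. -/
noncomputable def hexNome : ℝ := Real.exp (-(2 * Real.pi / √3))

theorem hexNome_pos : 0 < hexNome := Real.exp_pos _

theorem hexNome_le : hexNome ≤ 1 / 36 := by
  have h1 : (18 / 5 : ℝ) ≤ 2 * Real.pi / √3 := by
    have h3 : √3 < 1.7321 := by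
      rw [Real.sqrt_lt' (by norm_num)]
      norm_num
    rw [le_div_iff₀ (by positivity)]
    have := Real.pi_gt_d2
    linarith
  have h2 : (36 : ℝ) ≤ Real.exp (18 / 5) := by
    -- Fifth powers reduce the bound to an integer power of e.
    have h : (36 : ℝ) ^ 5 ≤ Real.exp (18 / 5) ^ 5 := by
      rw [← Real.exp_nat_mul, show ((5 : ℕ) : ℝ) * (18 / 5) = ((18 : ℕ) : ℝ) * 1 by norm_num,
        Real.exp_nat_mul]
      exact le_trans (by norm_num) (pow_le_pow_left₀ (by norm_num) Real.exp_one_gt_d9.le 18)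
    exact le_of_pow_le_pow_left₀ (by norm_num) (Real.exp_pos _).le h
  rw [hexNome, Real.exp_neg, one_div]
  exact inv_anti₀ (by norm_num) (h2.trans (Real.exp_le_exp.2 h1))

theorem hexGaussian_int (n : ℤ × ℤ) : hexGaussian n.1 n.2 = hexNome ^ hexNorm n := by
  rw [hexNome, ← Real.exp_nat_mul, hexNorm_cast, hexGaussian]
  congr 1
  ring

theorem hasSum_quarter_pow_natAbs :
    HasSum (fun n : ℤ => (1 / 4 : ℝ) ^ n.natAbs) (5 / 3) := by
  have h := hasSum_geometric_of_lt_one (r := (1 / 4 : ℝ)) (by norm_num) (by norm_num)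
  have h2 := h.mul_right (1 / 4)
  simp_rw [← pow_succ] at h2
  convert! HasSum.of_nat_of_neg_add_one (f := fun n : ℤ => (1 / 4 : ℝ) ^ n.natAbs)
    (by simpa using h) (m' := (1 - 1 / 4)⁻¹ * (1 / 4)) ?_ using 1
  · norm_num
  · convert! h2 using 3

/-- The bound decays in j = |k| + |l|, so that the tail sums as a product of two geometric series.
Seven is where j ≤ N implies 5 + j ≤ 2(N - 1), and 1/512 = 2/4⁵. -/
theorem mul_pow_le_of_seven_le {N j : ℕ} (hN : 7 ≤ N) (hj : j ^ 2 ≤ 4 * N) :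
    N * (1 / 36 : ℝ) ^ (N - 1) ≤ 1 / 512 * (1 / 4) ^ j := by
  have hjN : j ≤ N := by nlinarith
  obtain ⟨M, rfl⟩ : ∃ M, N = M + 1 := ⟨N - 1, by omega⟩
  have h1 : ((M + 1 : ℕ) : ℝ) ≤ 2 * 2 ^ M := by
    have := (Nat.lt_two_pow_self (n := M + 1)).le
    rw [pow_succ, mul_comm] at this
    exact_mod_cast this
  calc ((M + 1 : ℕ) : ℝ) * (1 / 36 : ℝ) ^ M ≤ 2 * 2 ^ M * (1 / 36) ^ M := by gcongr
    _ = 2 * (1 / 18) ^ M := by rw [mul_assoc, ← mul_pow]; norm_num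
    _ ≤ 2 * ((1 / 4) ^ 2) ^ M := by gcongr; norm_num
    _ = 2 * (1 / 4) ^ (2 * M) := by rw [pow_mul]
    _ ≤ 2 * (1 / 4) ^ (5 + j) := by
      gcongr ?_ * ?_
      exact pow_le_pow_of_le_one (by norm_num) (by norm_num) (by omega)
    _ = 1 / 512 * (1 / 4) ^ j := by rw [pow_add]; ring

/-- The lattice vectors of norm `1`. -/
def hexShellOne : Finset (ℤ × ℤ) := {(1, 0), (-1, 0), (0, 1), (0, -1), (1, -1), (-1, 1)}

/-- The lattice vectors of norm `3`. -/
def hexShellThree : Finset (ℤ × ℤ) := {(1, 1), (-1, -1), (2, -1), (-2, 1), (1, -2), (-1, 2)}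

/-- The lattice vectors of norm `4`. -/
def hexShellFour : Finset (ℤ × ℤ) := {(2, 0), (-2, 0), (0, 2), (0, -2), (2, -2), (-2, 2)}

theorem hasSum_indicator_finset (S : Finset (ℤ × ℤ)) (c : ℝ) :
    HasSum (fun n => if n ∈ S then c else 0) (S.card * c) := by
  have h := hasSum_sum_of_ne_finset_zero (s := S) (f := fun n => if n ∈ S then c else 0)
    (L := .unconditional _) fun b hb => by simp [hb]
  simpa using h

/-- One factor of the nome stays exact, since the sum is later weighed against the first shell; the
other factors are replaced by 1/36, whence 3/36² and 4/36³. The form does not take the values 2, 5,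
6, so the remaining norms are at least 7. -/
theorem hexNorm_mul_pow_le (n : ℤ × ℤ) :
    hexNorm n * hexNome ^ hexNorm n ≤ hexNome * ((if n ∈ hexShellOne then 1 else 0) +
      (if n ∈ hexShellThree then 3 / 1296 else 0) + (if n ∈ hexShellFour then 4 / 46656 else 0) +
      1 / 512 * ((1 / 4) ^ n.1.natAbs * (1 / 4) ^ n.2.natAbs)) := by
  have hq := hexNome_le
  have hq0 := hexNome_pos
  have hi : ∀ (S : Finset (ℤ × ℤ)) (c : ℝ), 0 ≤ c → 0 ≤ if n ∈ S then c else 0 := by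
    intro S c hc
    split_ifs <;> simp [hc]
  have i1 := hi hexShellOne 1 (by norm_num)
  have i3 := hi hexShellThree (3 / 1296) (by norm_num)
  have i4 := hi hexShellFour (4 / 46656) (by norm_num)
  have i5 : (0 : ℝ) ≤ 1 / 512 * ((1 / 4) ^ n.1.natAbs * (1 / 4) ^ n.2.natAbs) := by positivity
  rcases Nat.eq_zero_or_pos (hexNorm n) with h0 | hpos
  · rw [h0]
    simp only [Nat.cast_zero, zero_mul]
    positivity
  have hstep : (hexNorm n : ℝ) * hexNome ^ hexNorm n ≤
      hexNome * (hexNorm n * (1 / 36) ^ (hexNorm n - 1)) := by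
    obtain ⟨M, hM⟩ : ∃ M, hexNorm n = M + 1 := ⟨hexNorm n - 1, by omega⟩
    rw [hM, pow_succ, Nat.add_sub_cancel]
    have : hexNome ^ M ≤ (1 / 36) ^ M := pow_le_pow_left₀ hq0.le hq M
    calc _ = hexNome * (((M + 1 : ℕ) : ℝ) * hexNome ^ M) := by ring
      _ ≤ _ := by gcongr
  refine hstep.trans (mul_le_mul_of_nonneg_left ?_ hq0.le)
  have hc := hexNorm_cast_int n
  rcases le_or_gt 7 (hexNorm n) with h7 | h7
  · have hj : (n.1.natAbs + n.2.natAbs) ^ 2 ≤ 4 * hexNorm n := by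
      zify
      rw [hc]
      have := abs_mul_abs_self n.1
      have := abs_mul_abs_self n.2
      have := neg_abs_le (n.1 * n.2)
      rw [abs_mul] at this
      nlinarith [sq_nonneg (|n.1| - |n.2|)]
    have := mul_pow_le_of_seven_le h7 hj
    rw [pow_add] at this
    linarith
  · obtain ⟨k, l⟩ := n
    simp only at hc
    have h6 : k ^ 2 + k * l + l ^ 2 ≤ 6 := by omega
    have hk : k ^ 2 ≤ 8 := by nlinarith [sq_nonneg (k + 2 * l)]
    have hl : l ^ 2 ≤ 8 := by nlinarith [sq_nonneg (2 * k + l)]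
    have hk1 : -2 ≤ k := by nlinarith
    have hk2 : k ≤ 2 := by nlinarith
    have hl1 : -2 ≤ l := by nlinarith
    have hl2 : l ≤ 2 := by nlinarith
    have key : hexNorm (k, l) = 1 ∧ (k, l) ∈ hexShellOne ∨
        hexNorm (k, l) = 3 ∧ (k, l) ∈ hexShellThree ∨
        hexNorm (k, l) = 4 ∧ (k, l) ∈ hexShellFour := by
      clear hstep i1 i3 i4 i5 hi hc
      interval_cases k <;> interval_cases l <;> revert h7 hpos <;> decide
    rcases key with ⟨h, hm⟩ | ⟨h, hm⟩ | ⟨h, hm⟩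
    · rw [h, if_pos hm]
      norm_num at i3 i4 ⊢
      linarith
    · rw [h, if_pos hm]
      norm_num at i1 i4 ⊢
      linarith
    · rw [h, if_pos hm]
      norm_num at i1 i3 ⊢
      linarith

theorem summable_and_tsum_hexNorm_mul_le :
    Summable (fun n : ℤ × ℤ => hexNorm n * hexGaussian n.1 n.2) ∧
    ∑' n : ℤ × ℤ, hexNorm n * hexGaussian n.1 n.2 ≤ hexNome * (6 + 1 / 40) := by
  have hp := hasSum_quarter_pow_natAbs.summable
  have hp0 : ∀ n : ℤ, (0 : ℝ) ≤ (1 / 4) ^ n.natAbs := fun n => by positivity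
  have hs := ((((hasSum_indicator_finset hexShellOne 1).add
    (hasSum_indicator_finset hexShellThree (3 / 1296))).add
    (hasSum_indicator_finset hexShellFour (4 / 46656))).add
    ((hasSum_quarter_pow_natAbs.mul hasSum_quarter_pow_natAbs
      (hp.mul_of_nonneg hp hp0 hp0)).mul_left (1 / 512))).mul_left hexNome
  have hle : ∀ n : ℤ × ℤ, hexNorm n * hexGaussian n.1 n.2 ≤ _ := fun n =>
    (hexGaussian_int n).symm ▸ hexNorm_mul_pow_le n
  have hsum := hs.summable.of_nonneg_of_le
    (fun n : ℤ × ℤ => mul_nonneg (Nat.cast_nonneg _) (hexGaussian_pos _ _).le) hle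
  refine ⟨hsum, (hasSum_le hle hsum.hasSum hs).trans (mul_le_mul_of_nonneg_left ?_ hexNome_pos.le)⟩
  norm_num [show hexShellOne.card = 6 from rfl, show hexShellThree.card = 6 from rfl,
    show hexShellFour.card = 6 from rfl]

end

/-! ### The extrema of the heat kernel. -/

section

theorem norm_zpow_sub_one_le {u : ℂ} (hu : ‖u‖ = 1) (k : ℤ) : ‖u ^ k - 1‖ ≤ |(k : ℝ)| * ‖u - 1‖ := by
  have hu0 : u ≠ 0 := norm_ne_zero_iff.1 (by rw [hu]; exact one_ne_zero)
  have hnat : ∀ n : ℕ, ‖u ^ n - 1‖ ≤ n * ‖u - 1‖ := fun n => by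
    induction n with
    | zero => simp
    | succ n ih =>
      have : u ^ (n + 1) - 1 = u ^ n * (u - 1) + (u ^ n - 1) := by ring
      rw [this]
      refine (norm_add_le _ _).trans ?_
      rw [norm_mul, norm_pow, hu, one_pow, one_mul]
      push_cast
      linarith
  obtain ⟨n, rfl | rfl⟩ := k.eq_nat_or_neg
  · simpa using hnat n
  · have : u ^ (-(n : ℤ)) - 1 = -((u ^ n)⁻¹ * (u ^ n - 1)) := by
      rw [zpow_neg, zpow_natCast]
      field_simp
      ring
    rw [this, norm_neg, norm_mul, norm_inv, norm_pow, hu, one_pow, inv_one, one_mul]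
    simpa using hnat n

/-- Expanding (1 + A)(1 + B)(1 + C) = 1 shows that A + B + C equals minus the quadratic and cubic
terms: the first order disappears. -/
theorem norm_sum_sub_three_le {a b c : ℂ} (ha : ‖a‖ = 1) (h : a * b * c = 1) :
    ‖a + b + c - 3‖ ≤ 2 * (‖a - 1‖ ^ 2 + ‖b - 1‖ ^ 2 + ‖c - 1‖ ^ 2) := by
  have e : a + b + c - 3 = -((a - 1) * (b - 1) + (b - 1) * (c - 1) + (c - 1) * (a - 1) +
      (a - 1) * ((b - 1) * (c - 1))) := by
    linear_combination h
  have h2 : ‖a - 1‖ ≤ 2 := (norm_sub_le _ _).trans (by rw [ha, norm_one]; norm_num)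
  have h3 : ‖a + b + c - 3‖ ≤ ‖a - 1‖ * ‖b - 1‖ + ‖b - 1‖ * ‖c - 1‖ + ‖c - 1‖ * ‖a - 1‖ +
      ‖a - 1‖ * (‖b - 1‖ * ‖c - 1‖) := by
    rw [e, norm_neg]
    refine (norm_add_le _ _).trans ((add_le_add norm_add₃_le le_rfl).trans ?_)
    simp only [norm_mul, le_refl]
  have h4 := mul_le_mul_of_nonneg_right h2 (mul_nonneg (norm_nonneg (b - 1)) (norm_nonneg (c - 1)))
  nlinarith [sq_nonneg (‖a - 1‖ - ‖b - 1‖), sq_nonneg (‖b - 1‖ - ‖c - 1‖),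
    sq_nonneg (‖c - 1‖ - ‖a - 1‖), sq_nonneg ‖a - 1‖]

/-- Rotation of the hexagonal lattice by `2π / 3`, in lattice coordinates. -/
def hexRotation : ℤ × ℤ ≃ ℤ × ℤ where
  toFun n := (-n.1 - n.2, n.1)
  invFun n := (n.2, -n.1 - n.2)
  left_inv n := by ext <;> simp
  right_inv n := by ext <;> simp; ring

theorem hexNorm_hexRotation (n : ℤ × ℤ) : hexNorm (hexRotation n) = hexNorm n := by
  zify
  rw [hexNorm_cast_int, hexNorm_cast_int]
  simp only [hexRotation, Equiv.coe_fn_mk]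
  ring

/-- Cauchy–Schwarz, followed by k² + l² ≤ 2(k² + kl + l²). -/
theorem norm_zpow_mul_zpow_sub_one_sq_le {u v : ℂ} (hu : ‖u‖ = 1) (hv : ‖v‖ = 1) (n : ℤ × ℤ) :
    ‖u ^ n.1 * v ^ n.2 - 1‖ ^ 2 ≤ 2 * hexNorm n * (‖u - 1‖ ^ 2 + ‖v - 1‖ ^ 2) := by
  have e : u ^ n.1 * v ^ n.2 - 1 = u ^ n.1 * (v ^ n.2 - 1) + (u ^ n.1 - 1) := by ring
  have h : ‖u ^ n.1 * v ^ n.2 - 1‖ ≤ |(n.2 : ℝ)| * ‖v - 1‖ + |(n.1 : ℝ)| * ‖u - 1‖ := by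
    rw [e]
    refine (norm_add_le _ _).trans ?_
    rw [norm_mul, norm_zpow, hu, one_zpow, one_mul]
    exact add_le_add (norm_zpow_sub_one_le hv _) (norm_zpow_sub_one_le hu _)
  refine (pow_le_pow_left₀ (norm_nonneg _) h 2).trans ?_
  rw [hexNorm_cast]
  have h1 := sq_abs (n.1 : ℝ)
  have h2 := sq_abs (n.2 : ℝ)
  have h3 := sq_nonneg (|(n.2 : ℝ)| * ‖u - 1‖ - |(n.1 : ℝ)| * ‖v - 1‖)
  have h4 := mul_nonneg (sq_nonneg ((n.1 : ℝ) + n.2))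
    (add_nonneg (sq_nonneg ‖u - 1‖) (sq_nonneg ‖v - 1‖))
  have h5 : (|(n.2 : ℝ)| * ‖v - 1‖ + |(n.1 : ℝ)| * ‖u - 1‖) ^ 2 ≤
      (|(n.1 : ℝ)| ^ 2 + |(n.2 : ℝ)| ^ 2) * (‖u - 1‖ ^ 2 + ‖v - 1‖ ^ 2) := by linarith
  rw [h1, h2] at h5
  linarith

/-- The three vectors of a rotation orbit sum to zero, so their characters multiply to 1. The
constant is 12 = 2 · 3 · 2. -/
theorem norm_hexOrbit_sub_three_le {u v : ℂ} (hu : ‖u‖ = 1) (hv : ‖v‖ = 1) (n : ℤ × ℤ) :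
    ‖u ^ n.1 * v ^ n.2 + u ^ (hexRotation n).1 * v ^ (hexRotation n).2 +
      u ^ (hexRotation (hexRotation n)).1 * v ^ (hexRotation (hexRotation n)).2 - 3‖ ≤
      12 * hexNorm n * (‖u - 1‖ ^ 2 + ‖v - 1‖ ^ 2) := by
  have hu0 : u ≠ 0 := norm_ne_zero_iff.1 (by rw [hu]; exact one_ne_zero)
  have hv0 : v ≠ 0 := norm_ne_zero_iff.1 (by rw [hv]; exact one_ne_zero)
  have h1 := norm_zpow_mul_zpow_sub_one_sq_le hu hv n
  have h2 := norm_zpow_mul_zpow_sub_one_sq_le hu hv (hexRotation n)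
  have h3 := norm_zpow_mul_zpow_sub_one_sq_le hu hv (hexRotation (hexRotation n))
  rw [hexNorm_hexRotation] at h2 h3
  rw [hexNorm_hexRotation] at h3
  refine (norm_sum_sub_three_le ?_ ?_).trans ?_
  · rw [norm_mul, norm_zpow, norm_zpow, hu, hv, one_zpow, one_zpow, one_mul]
  · have : ∀ a b c d e f : ℤ, u ^ a * v ^ b * (u ^ c * v ^ d) * (u ^ e * v ^ f) =
        u ^ (a + c + e) * v ^ (b + d + f) := fun a b c d e f => by
      simp only [zpow_add₀ hu0, zpow_add₀ hv0]
      ring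
    rw [this]
    simp only [hexRotation, Equiv.coe_fn_mk]
    ring_nf
    simp
  · linarith

/-- The expression is affine in m. After reduction to y > 0 the hypothesis says x ≤ m ≤ 1, so the
endpoints suffice: m = x gives 5 + 76x², and m = 1 is the claim `f1`. -/
theorem hexTrig_polynomial_nonneg {x y m : ℝ} (hxy : x ^ 2 + y ^ 2 = 1) (hm : m ^ 2 ≤ 1)
    (h : 0 ≤ y * (m - x)) : 0 ≤ 5 + 38 * x * (m + x) + 2 * √3 * (y * (m - x)) := by
  have h3 : √3 ^ 2 = (3 : ℝ) := Real.sq_sqrt (by norm_num)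
  wlog hy : 0 ≤ y generalizing x y m
  · have := this (x := -x) (y := -y) (m := -m) (by linarith) (by linarith) (by linarith)
      (by linarith)
    linarith
  have hm1 : m ≤ 1 := by nlinarith
  have hx1 : x ≤ 1 := by nlinarith
  have hx2 : -1 ≤ x := by nlinarith
  have f1 : 0 ≤ 5 + 38 * x * (1 + x) + 2 * √3 * (y * (1 - x)) := by
    have hB : 0 ≤ 2 * √3 * (y * (1 - x)) := by
      have := mul_nonneg hy (sub_nonneg.2 hx1)
      positivity
    by_contra hneg
    have hA : 2 * √3 * (y * (1 - x)) < 9 / 2 - 38 * (x + 1 / 2) ^ 2 := by linarith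
    have hsq := mul_self_lt_mul_self hB hA
    have hBsq : (2 * √3 * (y * (1 - x))) * (2 * √3 * (y * (1 - x))) =
        12 * (1 - x ^ 2) * (1 - x) ^ 2 := by
      have : y ^ 2 = 1 - x ^ 2 := by linarith
      calc _ = 4 * √3 ^ 2 * y ^ 2 * (1 - x) ^ 2 := by ring
        _ = _ := by rw [h3, this]; ring
    rw [hBsq] at hsq
    -- The bound `f1` is attained at x = -1/2, y = √3/2; centring there exposes the double root as a
    -- factor e².
    obtain ⟨e, rfl⟩ : ∃ e, x = e - 1 / 2 := ⟨x + 1 / 2, by ring⟩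
    have he : e ^ 2 ≤ 9 / 76 := by nlinarith
    have he1 : -1 ≤ e := by nlinarith
    have : 0 ≤ e ^ 2 * (288 + 48 * e - 1456 * e ^ 2) :=
      mul_nonneg (sq_nonneg _) (by nlinarith)
    nlinarith
  rcases hy.eq_or_lt with rfl | hy
  · have hx : x ^ 2 = 1 := by linarith
    have : -1 ≤ x * m := by nlinarith [sq_nonneg (x + m)]
    nlinarith
  · have hmx : x ≤ m := by
      by_contra hlt
      nlinarith
    rcases hx1.eq_or_lt with rfl | hx1
    · have : m = 1 := le_antisymm hm1 hmx
      subst this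
      norm_num
    · have : 0 ≤ (1 - x) * (5 + 38 * x * (m + x) + 2 * √3 * (y * (m - x))) := by
        have e1 := mul_nonneg (sub_nonneg.2 hm1) (by positivity : 0 ≤ 5 + 76 * x ^ 2)
        have e2 := mul_nonneg (sub_nonneg.2 hmx) f1
        linarith
      exact nonneg_of_mul_nonneg_right this (by linarith)

-- With x = cos φ, y = sin φ, m = cos ψ, the difference of the two sides in the first alternative is
-- the polynomial above plus 1 + 2x² + 2√3xy, which is nonnegative because cos(2φ + 2π/3) ≤ 1. The
-- sign of y(m - x) decides which of the two minima to compare with.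
open Real in
theorem hexTrig_le (α β : ℝ) :
    (2 - 2 * cos (α - 2 * π / 3)) + (2 - 2 * cos (β - 2 * π / 3)) ≤
      10 * (3 + 2 * cos α + 2 * cos β + 2 * cos (α + β)) ∨
    (2 - 2 * cos (α + 2 * π / 3)) + (2 - 2 * cos (β + 2 * π / 3)) ≤
      10 * (3 + 2 * cos α + 2 * cos β + 2 * cos (α + β)) := by
  have hc : cos (2 * π / 3) = -1 / 2 := by
    rw [show 2 * π / 3 = π - π / 3 by ring, cos_pi_sub, cos_pi_div_three]; ring
  have hs : sin (2 * π / 3) = √3 / 2 := by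
    rw [show 2 * π / 3 = π - π / 3 by ring, sin_pi_sub, sin_pi_div_three]
  obtain ⟨φ, ψ, rfl, rfl⟩ : ∃ φ ψ, α = φ + ψ ∧ β = φ - ψ :=
    ⟨(α + β) / 2, (α - β) / 2, by ring, by ring⟩
  have h2 : φ + ψ + (φ - ψ) = 2 * φ := by ring
  have hφ := cos_sq_add_sin_sq φ
  have hψ := cos_sq_le_one ψ
  have k1 := cos_le_one (2 * φ + 2 * π / 3)
  have k2 := cos_le_one (2 * φ - 2 * π / 3)
  rw [h2]
  simp only [cos_sub _ (2 * π / 3), cos_add _ (2 * π / 3), hc, hs] at k1 k2 ⊢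
  simp only [cos_add, cos_sub, sin_add, sin_sub, cos_two_mul, sin_two_mul] at k1 k2 ⊢
  rcases le_total 0 (sin φ * (cos ψ - cos φ)) with h | h
  · left
    have := hexTrig_polynomial_nonneg hφ hψ h
    linarith
  · right
    have := hexTrig_polynomial_nonneg (x := cos φ) (y := -sin φ) (m := cos ψ) (by linarith) hψ
      (by linarith)
    linarith

open Real

/-- The cosine attached to a lattice vector at the point `(x, y)` of the torus. -/
noncomputable def hexCos (x y : ℝ) (n : ℤ × ℤ) : ℝ := cos (2 * π * (n.1 * y - n.2 * x))

theorem summable_hexGaussian_mul_hexCos (x y : ℝ) :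
    Summable fun n : ℤ × ℤ => hexGaussian n.1 n.2 * hexCos x y n := by
  refine summable_hexGaussian_int.of_norm_bounded fun n => ?_
  rw [norm_mul, Real.norm_of_nonneg (hexGaussian_pos _ _).le]
  exact mul_le_of_le_one_right (hexGaussian_pos _ _).le (abs_cos_le_one _)

/-- The sum over a rotation orbit of the change of `hexCos` from `(1/3, 1/3)` to `(x, y)`. -/
noncomputable def hexOrbitDefect (x y : ℝ) (n : ℤ × ℤ) : ℝ :=
  (hexCos x y n - hexCos (1 / 3) (1 / 3) n) +
  (hexCos x y (hexRotation n) - hexCos (1 / 3) (1 / 3) (hexRotation n)) +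
  (hexCos x y (hexRotation (hexRotation n)) -
    hexCos (1 / 3) (1 / 3) (hexRotation (hexRotation n)))

/-- Here u and v measure the displacement from (1/3, 1/3). The factor ζ^(k - l) is constant on an
orbit, because the rotation preserves k - l modulo 3, so it comes out of the orbit sum. -/
theorem abs_hexOrbitDefect_le (x y : ℝ) (n : ℤ × ℤ) :
    |hexOrbitDefect x y n| ≤ 12 * hexNorm n * ((2 - 2 * cos (2 * π * x - 2 * π / 3)) +
      (2 - 2 * cos (2 * π * y - 2 * π / 3))) := by
  set u : ℂ := Complex.exp ((2 * π * y - 2 * π / 3 : ℝ) * Complex.I) with hu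
  set v : ℂ := Complex.exp ((-(2 * π * x - 2 * π / 3) : ℝ) * Complex.I) with hv
  set ζ : ℂ := Complex.exp ((2 * π / 3 : ℝ) * Complex.I) with hζ
  have hu1 : ‖u‖ = 1 := Complex.norm_exp_ofReal_mul_I _
  have hv1 : ‖v‖ = 1 := Complex.norm_exp_ofReal_mul_I _
  have hζ1 : ‖ζ‖ = 1 := Complex.norm_exp_ofReal_mul_I _
  have hζ0 : ζ ≠ 0 := Complex.exp_ne_zero _
  have hζ3 : ζ ^ (3 : ℤ) = 1 := by
    rw [hζ, ← Complex.exp_int_mul]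
    convert Complex.exp_two_pi_mul_I using 2
    push_cast
    ring
  have hnorm : ∀ θ : ℝ, ‖Complex.exp (θ * Complex.I) - 1‖ ^ 2 = 2 - 2 * cos θ := fun θ => by
    rw [← Complex.normSq_eq_norm_sq, Complex.normSq_apply]
    simp only [Complex.sub_re, Complex.sub_im, Complex.exp_ofReal_mul_I_re,
      Complex.exp_ofReal_mul_I_im, Complex.one_re, Complex.one_im]
    linarith [sin_sq_add_cos_sq θ]
  have h0 : ∀ n : ℤ × ℤ, hexCos (1 / 3) (1 / 3) n = (ζ ^ (n.1 - n.2)).re := fun n => by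
    rw [hζ, ← Complex.exp_int_mul, hexCos, ← Complex.exp_ofReal_mul_I_re]
    congr 2
    push_cast
    ring
  have h1 : ∀ n : ℤ × ℤ, hexCos x y n = (ζ ^ (n.1 - n.2) * (u ^ n.1 * v ^ n.2)).re := fun n => by
    rw [hζ, hu, hv, ← Complex.exp_int_mul, ← Complex.exp_int_mul, ← Complex.exp_int_mul, hexCos,
      ← Complex.exp_ofReal_mul_I_re, ← Complex.exp_add, ← Complex.exp_add]
    congr 2
    push_cast
    ring
  have hrot : ∀ n : ℤ × ℤ, ζ ^ ((hexRotation n).1 - (hexRotation n).2) = ζ ^ (n.1 - n.2) :=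
    fun n => by
    have : (hexRotation n).1 - (hexRotation n).2 = (n.1 - n.2) + 3 * (-n.1) := by
      simp only [hexRotation, Equiv.coe_fn_mk]; ring
    rw [this, zpow_add₀ hζ0, zpow_mul, hζ3, one_zpow, mul_one]
  have hO : hexOrbitDefect x y n = (ζ ^ (n.1 - n.2) * (u ^ n.1 * v ^ n.2 +
      u ^ (hexRotation n).1 * v ^ (hexRotation n).2 +
      u ^ (hexRotation (hexRotation n)).1 * v ^ (hexRotation (hexRotation n)).2 - 3)).re := by
    rw [hexOrbitDefect]
    simp only [h0, h1, hrot, ← Complex.sub_re, ← Complex.add_re]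
    congr 1
    ring
  have hfin := norm_hexOrbit_sub_three_le hu1 hv1 n
  rw [hu, hv, hnorm, hnorm, cos_neg, ← hu, ← hv] at hfin
  rw [hO]
  refine (Complex.abs_re_le_norm _).trans ?_
  rw [norm_mul, norm_zpow, hζ1, one_zpow, one_mul]
  linarith

theorem hexOrbitDefect_of_mem_hexShellOne (x y : ℝ) {n : ℤ × ℤ} (hn : n ∈ hexShellOne) :
    hexOrbitDefect x y n = (3 + 2 * cos (2 * π * x) + 2 * cos (2 * π * y) +
      2 * cos (2 * π * x + 2 * π * y)) / 2 := by
  have h1 : cos (2 * π / 3) = -1 / 2 := by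
    rw [show 2 * π / 3 = π - π / 3 by ring, cos_pi_sub, cos_pi_div_three]; ring
  have h2 : cos (4 * π / 3) = -1 / 2 := by
    rw [show 4 * π / 3 = π / 3 + π by ring, cos_add_pi, cos_pi_div_three]; ring
  have a1 : ∀ x y, hexCos x y (1, 0) = cos (2 * π * y) := fun x y => by simp [hexCos]
  have a2 : ∀ x y, hexCos x y (0, 1) = cos (2 * π * x) := fun x y => by simp [hexCos]
  have a3 : ∀ x y, hexCos x y (1, -1) = cos (2 * π * x + 2 * π * y) := fun x y => by
    simp [hexCos]; ring_nf
  have a4 : ∀ x y k l, hexCos x y (-k, -l) = hexCos x y (k, l) := fun x y k l => by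
    rw [hexCos, hexCos, ← cos_neg]
    push_cast
    ring_nf
  have b1 : hexCos (1 / 3) (1 / 3) (1, 0) = -1 / 2 := by rw [a1, ← h1]; ring_nf
  have b2 : hexCos (1 / 3) (1 / 3) (0, 1) = -1 / 2 := by rw [a2, ← h1]; ring_nf
  have b3 : hexCos (1 / 3) (1 / 3) (1, -1) = -1 / 2 := by rw [a3, ← h2]; ring_nf
  have c1 := fun x y => a4 x y 1 0
  have c2 := fun x y => a4 x y 0 1
  have c3 := fun x y => a4 x y 1 (-1)
  norm_num at c1 c2 c3
  simp only [hexShellOne, Finset.mem_insert, Finset.mem_singleton] at hn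
  rcases hn with rfl | rfl | rfl | rfl | rfl | rfl <;>
    norm_num [hexOrbitDefect, hexRotation, c1, c2, c3] <;>
    norm_num [a1, a2, a3] at b1 b2 b3 ⊢ <;> linarith

/-- The first shell gives 3qg exactly, and the other shells lose at most 12Hq/40. The hypothesis H ≤
10g makes this loss at most 3qg. -/
theorem tsum_hexGaussian_mul_hexCos_third_le (x y : ℝ)
    (h : (2 - 2 * cos (2 * π * x - 2 * π / 3)) + (2 - 2 * cos (2 * π * y - 2 * π / 3)) ≤
      10 * (3 + 2 * cos (2 * π * x) + 2 * cos (2 * π * y) + 2 * cos (2 * π * x + 2 * π * y))) :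
    ∑' n : ℤ × ℤ, hexGaussian n.1 n.2 * hexCos (1 / 3) (1 / 3) n ≤
      ∑' n : ℤ × ℤ, hexGaussian n.1 n.2 * hexCos x y n := by
  set H := (2 - 2 * cos (2 * π * x - 2 * π / 3)) + (2 - 2 * cos (2 * π * y - 2 * π / 3)) with hH
  set g := 3 + 2 * cos (2 * π * x) + 2 * cos (2 * π * y) + 2 * cos (2 * π * x + 2 * π * y) with hg
  have hH0 : 0 ≤ H := by
    have := cos_le_one (2 * π * x - 2 * π / 3)
    have := cos_le_one (2 * π * y - 2 * π / 3)
    linarith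
  have hs1 := summable_hexGaussian_mul_hexCos x y
  have hs2 := summable_hexGaussian_mul_hexCos (1 / 3) (1 / 3)
  obtain ⟨hF, hFle⟩ := summable_and_tsum_hexNorm_mul_le
  have hG : ∀ n : ℤ × ℤ, hexGaussian (hexRotation n).1 (hexRotation n).2 = hexGaussian n.1 n.2 :=
    fun n => by rw [hexGaussian_int, hexGaussian_int, hexNorm_hexRotation]
  set D : ℤ × ℤ → ℝ := fun n => hexGaussian n.1 n.2 * hexCos x y n -
    hexGaussian n.1 n.2 * hexCos (1 / 3) (1 / 3) n with hD
  have hDs : Summable D := hs1.sub hs2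
  have hDs' : Summable fun n => D (hexRotation n) := hexRotation.summable_iff.2 hDs
  have hDs'' : Summable fun n => D (hexRotation (hexRotation n)) := hexRotation.summable_iff.2 hDs'
  have hO : ∀ n, D n + D (hexRotation n) + D (hexRotation (hexRotation n)) =
      hexGaussian n.1 n.2 * hexOrbitDefect x y n := fun n => by
    simp only [hD, hG, hexOrbitDefect]
    ring
  have hOs : Summable fun n : ℤ × ℤ => hexGaussian n.1 n.2 * hexOrbitDefect x y n :=
    ((hDs.add hDs').add hDs'').congr hO
  have h3 : 3 * ∑' n, D n = ∑' n : ℤ × ℤ, hexGaussian n.1 n.2 * hexOrbitDefect x y n := by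
    rw [← tsum_congr hO, (hDs.add hDs').tsum_add hDs'', hDs.tsum_add hDs',
      hexRotation.tsum_eq (fun n => D (hexRotation n)), hexRotation.tsum_eq D]
    ring
  have hsum := hOs.add (hF.mul_left (12 * H))
  -- Adding 12HN makes every term nonnegative, so the sum is bounded below by its part over the
  -- first shell.
  have hlow := hsum.sum_le_tsum hexShellOne fun n _ => by
    have := abs_le.1 (abs_hexOrbitDefect_le x y n)
    have h1 : 0 ≤ hexOrbitDefect x y n + 12 * hexNorm n * H := by linarith
    have := mul_nonneg (hexGaussian_pos (n.1 : ℝ) n.2).le h1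
    linarith
  rw [hOs.tsum_add (hF.mul_left _), tsum_mul_left, ← h3] at hlow
  have hconst : ∑ n ∈ hexShellOne, (hexGaussian (n.1 : ℝ) n.2 * hexOrbitDefect x y n +
      12 * H * (hexNorm n * hexGaussian (n.1 : ℝ) n.2)) = 6 * (hexNome * (g / 2 + 12 * H)) := by
    have hN : ∀ n ∈ hexShellOne, hexNorm n = 1 := by decide
    rw [Finset.sum_congr rfl (g := fun _ => hexNome * (g / 2 + 12 * H)) fun n hn => by
      rw [hexOrbitDefect_of_mem_hexShellOne x y hn, hexGaussian_int, hN n hn, ← hg]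
      push_cast
      ring]
    rw [Finset.sum_const, show hexShellOne.card = 6 from rfl]
    simp
  rw [hconst] at hlow
  have h12 := mul_le_mul_of_nonneg_left hFle (mul_nonneg (by norm_num : (0 : ℝ) ≤ 12) hH0)
  have hqg := mul_le_mul_of_nonneg_left h hexNome_pos.le
  have hfin : 0 ≤ ∑' n, D n := by linarith
  rw [hs1.tsum_sub hs2] at hfin
  linarith

theorem tsum_hexGaussian_mul_hexCos_min (x y : ℝ) :
    ∑' n : ℤ × ℤ, hexGaussian n.1 n.2 * hexCos (1 / 3) (1 / 3) n ≤
      ∑' n : ℤ × ℤ, hexGaussian n.1 n.2 * hexCos x y n := by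
  rcases hexTrig_le (2 * π * x) (2 * π * y) with h | h
  · exact tsum_hexGaussian_mul_hexCos_third_le x y h
  -- The kernel is even, which exchanges the two minima.
  · have e : ∀ n, hexCos x y n = hexCos (-x) (-y) n := fun n => by
      rw [hexCos, hexCos, ← cos_neg]
      ring_nf
    simp_rw [e]
    refine tsum_hexGaussian_mul_hexCos_third_le (-x) (-y) ?_
    have e1 : ∀ t : ℝ, cos (2 * π * -t) = cos (2 * π * t) := fun t => by
      rw [← cos_neg]; ring_nf
    have e2 : ∀ t : ℝ, cos (2 * π * -t - 2 * π / 3) = cos (2 * π * t + 2 * π / 3) := fun t => by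
      rw [← cos_neg]; ring_nf
    have e3 : cos (2 * π * -x + 2 * π * -y) = cos (2 * π * x + 2 * π * y) := by
      rw [← cos_neg]; ring_nf
    rw [e1, e1, e2, e2, e3]
    exact h

theorem re_heatKernel_hexLattice (z : Fin 2 → ℝ) :
    (heatKernel hexLattice 1 z).re =
      ∑' n : ℤ × ℤ, hexGaussian n.1 n.2 * hexCos (z 0) (z 1) n := by
  rw [heatKernel, Complex.re_tsum (summable_heatTerm_hexLattice z)]
  refine tsum_congr fun n => ?_
  rw [heatTerm_hexLattice, Complex.re_ofReal_mul, Complex.exp_ofReal_mul_I_re, hexCos]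

theorem re_heatKernel_hexLattice_le (z : Fin 2 → ℝ) :
    (heatKernel hexLattice 1 z).re ≤ ∑' n : ℤ × ℤ, hexGaussian n.1 n.2 := by
  rw [re_heatKernel_hexLattice]
  exact (summable_hexGaussian_mul_hexCos _ _).tsum_le_tsum
    (fun n => mul_le_of_le_one_right (hexGaussian_pos _ _).le (cos_le_one _))
    summable_hexGaussian_int

theorem le_re_heatKernel_hexLattice (z : Fin 2 → ℝ) :
    (heatKernel hexLattice 1 ![1 / 3, 1 / 3]).re ≤ (heatKernel hexLattice 1 z).re := by
  rw [re_heatKernel_hexLattice, re_heatKernel_hexLattice]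
  exact tsum_hexGaussian_mul_hexCos_min _ _

theorem heatKernel_hexLattice_zero :
    heatKernel hexLattice 1 0 = (∑' n : ℤ × ℤ, hexGaussian n.1 n.2 : ℝ) := by
  rw [heatKernel_hexLattice_eq_tsum]
  simp

end

/-! ### The cubic identity a³ = b³ + c³. -/

section

/-- The product of three hexagonal Gaussians, each shifted by `(s, s)`. -/
noncomputable def hexTriple (s : ℝ) (p : (ℤ × ℤ) × (ℤ × ℤ) × (ℤ × ℤ)) : ℝ :=
  hexGaussian (p.1.1 + s) (p.1.2 + s) *
    (hexGaussian (p.2.1.1 + s) (p.2.1.2 + s) * hexGaussian (p.2.2.1 + s) (p.2.2.2 + s))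

/-- The residue modulo `√-3` of the sum of three Eisenstein integers, as an integer mod `3`. -/
def tripleResidue (p : (ℤ × ℤ) × (ℤ × ℤ) × (ℤ × ℤ)) : ℤ :=
  (p.1.1 - p.1.2) + ((p.2.1.1 - p.2.1.2) + (p.2.2.1 - p.2.2.2))

/-- The part of the sum of `hexTriple` over a residue class. -/
noncomputable def hexTripleSum (s : ℝ) (r : ℤ) : ℝ :=
  ∑' p, if tripleResidue p % 3 = r then hexTriple s p else 0

theorem summable_hexTriple (s : ℝ) : Summable (hexTriple s) := by
  have h := summable_hexGaussian s s
  have h0 : ∀ n : ℤ × ℤ, 0 ≤ hexGaussian ((n.1 : ℝ) + s) (n.2 + s) :=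
    fun _ => (hexGaussian_pos _ _).le
  exact h.mul_of_nonneg (h.mul_of_nonneg h h0 h0) h0 fun _ => mul_nonneg (h0 _) (h0 _)

theorem hexTriple_nonneg (s : ℝ) (p) : 0 ≤ hexTriple s p :=
  mul_nonneg (hexGaussian_pos _ _).le (mul_nonneg (hexGaussian_pos _ _).le (hexGaussian_pos _ _).le)

theorem summable_hexTriple_residue (s : ℝ) (r : ℤ) :
    Summable fun p => if tripleResidue p % 3 = r then hexTriple s p else 0 := by
  refine (summable_hexTriple s).of_nonneg_of_le (fun p => ?_) fun p => ?_
  · split_ifs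
    exacts [hexTriple_nonneg s p, le_rfl]
  · split_ifs
    exacts [le_rfl, hexTriple_nonneg s p]

theorem pow_three_tsum_hexGaussian (s : ℝ) :
    (∑' n : ℤ × ℤ, hexGaussian (n.1 + s) (n.2 + s)) ^ 3 =
      hexTripleSum s 0 + hexTripleSum s 1 + hexTripleSum s 2 := by
  have h := summable_hexGaussian s s
  have h0 : ∀ n : ℤ × ℤ, 0 ≤ hexGaussian ((n.1 : ℝ) + s) (n.2 + s) :=
    fun _ => (hexGaussian_pos _ _).le
  have h2 := h.mul_of_nonneg h h0 h0
  rw [pow_three, h.tsum_mul_tsum h h2, h.tsum_mul_tsum h2 (summable_hexTriple s), hexTripleSum,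
    hexTripleSum, hexTripleSum, ← (summable_hexTriple_residue s 0).tsum_add
    (summable_hexTriple_residue s 1), ← ((summable_hexTriple_residue s 0).add
    (summable_hexTriple_residue s 1)).tsum_add (summable_hexTriple_residue s 2)]
  refine tsum_congr fun p => ?_
  have : tripleResidue p % 3 = 0 ∨ tripleResidue p % 3 = 1 ∨ tripleResidue p % 3 = 2 := by omega
  rcases this with h | h | h <;> simp [h, hexTriple]

theorem hexTripleSum_one_eq_two : hexTripleSum 0 1 = hexTripleSum 0 2 := by
  rw [hexTripleSum, hexTripleSum, ← (Equiv.neg _).tsum_eq]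
  refine tsum_congr fun p => ?_
  have h : tripleResidue (Equiv.neg _ p) = -tripleResidue p := by
    simp [tripleResidue]; ring
  have h2 : hexTriple 0 (Equiv.neg _ p) = hexTriple 0 p := by
    simp [hexTriple, hexGaussian]
  rw [h, h2]
  congr 1
  exact propext ⟨fun _ => by omega, fun _ => by omega⟩

/-- Multiplication by a primitive cube root of unity about the centre of a triangle. -/
def triangleRotation : ℤ × ℤ ≃ ℤ × ℤ where
  toFun n := (-n.1 - n.2 - 1, n.1)
  invFun n := (n.2, -n.1 - n.2 - 1)
  left_inv n := by ext <;> simp; ring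
  right_inv n := by ext <;> simp; ring

/-- Rotating the first entry alone about the centre of its triangle keeps the Gaussian and lowers
the residue by one. Hence the three classes have equal sums. -/
theorem hexTripleSum_third {r r' : ℤ} (h : (r' + 1 - r) % 3 = 0) (hr : 0 ≤ r ∧ r < 3)
    (hr' : 0 ≤ r' ∧ r' < 3) : hexTripleSum (1 / 3) r = hexTripleSum (1 / 3) r' := by
  rw [hexTripleSum, hexTripleSum, ← (triangleRotation.prodCongr (Equiv.refl _)).tsum_eq
    (fun p => if tripleResidue p % 3 = r' then hexTriple (1 / 3) p else 0)]
  refine tsum_congr fun p => ?_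
  have h1 : (tripleResidue (triangleRotation.prodCongr (Equiv.refl _) p) + 1
      - tripleResidue p) % 3 = 0 := by
    simp [tripleResidue, triangleRotation]; omega
  have h2 : hexTriple (1 / 3) (triangleRotation.prodCongr (Equiv.refl _) p) =
      hexTriple (1 / 3) p := by
    simp only [hexTriple, hexGaussian, triangleRotation, Equiv.prodCongr_apply, Prod.map,
      Equiv.coe_fn_mk, Equiv.refl_apply]
    congr 2
    push_cast
    ring
  rw [h2]
  congr 1
  exact propext ⟨fun _ => by omega, fun _ => by omega⟩

/-- Read (k, l) as k + lη with η = exp(iπ/3) and ω = η². The map (x, y, z) ↦ (x + y + z, x + ωy +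
ω²z, x + ω²y + ωz)/(2 - η) is unitary since |2 - η|² = 3. If x + y + z = 1 + (2 - η)t, its entries
are integers shifted by 1/(2 - η) = (1 + η)/3. Both sides are parametrized by (t, y, z), through `g`
and `g'`. -/
theorem hexTripleSum_one_eq : hexTripleSum 0 1 = hexTripleSum (1 / 3) 0 := by
  let g : (ℤ × ℤ) × (ℤ × ℤ) × (ℤ × ℤ) → (ℤ × ℤ) × (ℤ × ℤ) × (ℤ × ℤ) := fun ⟨t, y, z⟩ =>
    ((1 + 2 * t.1 + t.2 - y.1 - z.1, t.2 - t.1 - y.2 - z.2), y, z)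
  let g' : (ℤ × ℤ) × (ℤ × ℤ) × (ℤ × ℤ) → (ℤ × ℤ) × (ℤ × ℤ) × (ℤ × ℤ) := fun ⟨t, y, z⟩ =>
    (t, (t.1 - y.1 + z.2, t.2 - y.2 - z.1 - z.2), (t.1 + y.2 - z.1, t.2 - y.1 - y.2 - z.2))
  have hg : Function.Injective g := by
    rintro ⟨⟨a, b⟩, ⟨c, d⟩, e, f⟩ ⟨⟨a', b'⟩, ⟨c', d'⟩, e', f'⟩ h
    simp only [g, Prod.mk.injEq] at h ⊢
    omega
  have hg' : Function.Injective g' := by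
    rintro ⟨⟨a, b⟩, ⟨c, d⟩, e, f⟩ ⟨⟨a', b'⟩, ⟨c', d'⟩, e', f'⟩ h
    simp only [g', Prod.mk.injEq] at h ⊢
    omega
  rw [hexTripleSum, hexTripleSum,
    ← hg.tsum_eq (f := fun p => if tripleResidue p % 3 = 1 then hexTriple 0 p else 0),
    ← hg'.tsum_eq (f := fun p => if tripleResidue p % 3 = 0 then hexTriple (1 / 3) p else 0)]
  · refine tsum_congr ?_
    rintro ⟨⟨a, b⟩, ⟨c, d⟩, e, f⟩
    rw [if_pos, if_pos]
    · simp only [hexTriple, hexGaussian, ← Real.exp_add, g, g']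
      congr 1
      push_cast
      ring
    · simp only [g', tripleResidue]; omega
    · simp only [g, tripleResidue]; omega
  · rintro ⟨⟨a, b⟩, ⟨c, d⟩, e, f⟩ h
    have h1 : tripleResidue ((a, b), (c, d), e, f) % 3 = 0 := by
      by_contra h2
      exact h (if_neg h2)
    simp only [tripleResidue] at h1
    obtain ⟨m, hm⟩ : ∃ m, (c - a) + (f - b) - ((d - b) - (e - a) - (f - b)) = 3 * m :=
      ⟨((c - a) + (f - b) - ((d - b) - (e - a) - (f - b))) / 3, by omega⟩
    set l := (d - b) - (e - a) - (f - b) with hl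
    refine ⟨((a, b), (-m, -m - l), (-m - l - (e - a), m + m + l - (f - b))), ?_⟩
    simp only [g', Prod.mk.injEq, true_and]
    omega
  · rintro ⟨⟨a, b⟩, ⟨c, d⟩, e, f⟩ h
    have h1 : tripleResidue ((a, b), (c, d), e, f) % 3 = 1 := by
      by_contra h2
      exact h (if_neg h2)
    simp only [tripleResidue] at h1
    obtain ⟨m, hm⟩ : ∃ m, (a + c + e) - (b + d + f) = 1 + 3 * m :=
      ⟨((a + c + e) - (b + d + f)) / 3, by omega⟩
    refine ⟨((m, m + (b + d + f)), (c, d), (e, f)), ?_⟩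
    simp only [g, Prod.mk.injEq, and_true]
    omega

-- The residue classes of the cube get weights 1, ζ, ζ²; classes 1 and 2 have equal sums and ζ + ζ²
-- = -1.
open Complex in
theorem pow_three_tsum_hexGaussian_mul_exp :
    (∑' n : ℤ × ℤ, (hexGaussian n.1 n.2 : ℂ) * cexp ((2 * Real.pi / 3 * (n.1 - n.2) : ℝ) * I)) ^ 3 =
      (hexTripleSum 0 0 - hexTripleSum 0 1 : ℝ) := by
  set ζ : ℂ := cexp ((2 * Real.pi / 3 : ℝ) * I) with hζ
  have hζ0 : ζ ≠ 0 := Complex.exp_ne_zero _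
  have hprim : IsPrimitiveRoot ζ 3 := by
    convert Complex.isPrimitiveRoot_exp 3 (by norm_num) using 1
    rw [hζ]
    congr 1
    push_cast
    ring
  have h3 : ζ ^ 3 = 1 := hprim.pow_eq_one
  have hsum : 1 + ζ + ζ ^ 2 = 0 := by
    have := hprim.geom_sum_eq_zero (by norm_num)
    simpa [Finset.sum_range_succ] using this
  set f : ℤ × ℤ → ℂ := fun n => (hexGaussian n.1 n.2 : ℂ) * ζ ^ (n.1 - n.2) with hf
  have hfe : ∀ n : ℤ × ℤ, (hexGaussian n.1 n.2 : ℂ) *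
      cexp ((2 * Real.pi / 3 * (n.1 - n.2) : ℝ) * I) = f n := by
    intro n
    rw [hf, hζ]
    simp only
    rw [← Complex.exp_int_mul]
    congr 2
    push_cast
    ring
  have hnζ : ‖ζ‖ = 1 := Complex.norm_exp_ofReal_mul_I _
  have hfs : Summable fun n => ‖f n‖ := by
    refine summable_hexGaussian_int.congr fun n => ?_
    rw [hf, norm_mul, norm_zpow, hnζ, one_zpow, mul_one, Complex.norm_real,
      Real.norm_of_nonneg (hexGaussian_pos _ _).le]
  have hfs2 := Summable.mul_norm hfs hfs
  have hr := fun r => (Complex.hasSum_ofReal.2 (summable_hexTriple_residue 0 r).hasSum)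
  simp_rw [hfe]
  rw [pow_three, tsum_mul_tsum_of_summable_norm hfs hfs, tsum_mul_tsum_of_summable_norm hfs hfs2]
  have hres : (hexTripleSum 0 0 - hexTripleSum 0 1 : ℝ) =
      (hexTripleSum 0 0 : ℂ) + ζ * hexTripleSum 0 1 + ζ ^ 2 * hexTripleSum 0 2 := by
    rw [← hexTripleSum_one_eq_two]
    push_cast
    linear_combination (-(hexTripleSum 0 1 : ℂ)) * hsum
  rw [hres]
  refine HasSum.tsum_eq ?_
  convert! ((hr 0).add ((hr 1).mul_left ζ)).add ((hr 2).mul_left (ζ ^ 2)) using 1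
  funext p
  have hz : f p.1 * (f p.2.1 * f p.2.2) = (hexTriple 0 p : ℂ) * ζ ^ tripleResidue p := by
    simp only [hf, hexTriple, tripleResidue, zpow_add₀ hζ0, add_zero]
    push_cast
    ring
  rw [hz]
  have hd := Int.emod_add_mul_ediv (tripleResidue p) 3
  have hzm : ζ ^ tripleResidue p = ζ ^ (tripleResidue p % 3) := by
    conv_lhs => rw [← hd]
    rw [zpow_add₀ hζ0, zpow_mul]
    norm_cast
    simp [h3]
  rw [hzm]
  have : tripleResidue p % 3 = 0 ∨ tripleResidue p % 3 = 1 ∨ tripleResidue p % 3 = 2 := by omega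
  rcases this with h | h | h
  · simp [h]
  · simp [h, mul_comm]
  · simp [h, mul_comm]

theorem heatKernel_hexLattice_third :
    heatKernel hexLattice 1 ![1 / 3, 1 / 3] =
      ∑' n : ℤ × ℤ, (hexGaussian n.1 n.2 : ℂ) *
        Complex.exp ((2 * Real.pi / 3 * (n.1 - n.2) : ℝ) * Complex.I) := by
  rw [heatKernel]
  refine tsum_congr fun n => ?_
  rw [heatTerm_hexLattice]
  congr 4
  simp
  ring

/-- The cubic identity `a³ = b³ + c³` at the self-dual nome, where `b = c`. -/
theorem pow_three_tsum_hexGaussian_eq_two_mul :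
    (∑' n : ℤ × ℤ, hexGaussian n.1 n.2) ^ 3 =
      2 * (∑' n : ℤ × ℤ, hexGaussian (n.1 + 1 / 3) (n.2 + 1 / 3)) ^ 3 := by
  have h := pow_three_tsum_hexGaussian_mul_exp
  rw [← heatKernel_hexLattice_third, heatKernel_hexLattice_eq_tsum] at h
  simp only [Matrix.cons_val_zero, Matrix.cons_val_one] at h
  norm_cast at h
  have h1 := pow_three_tsum_hexGaussian 0
  have h2 := pow_three_tsum_hexGaussian (1 / 3)
  have h3 := hexTripleSum_one_eq_two
  have h4 := hexTripleSum_one_eq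
  have h5 := hexTripleSum_third (r := 0) (r' := 2) (by norm_num) (by norm_num) (by norm_num)
  have h6 := hexTripleSum_third (r := 1) (r' := 0) (by norm_num) (by norm_num) (by norm_num)
  simp only [add_zero] at h1
  linarith

end

/-! ### Jacobi theta constants. -/

section

/-- Jacobi's theta constant `θ₂` at the nome `exp (-π t)`. -/
noncomputable def thetaTwo (t : ℝ) : ℝ := ∑' n : ℤ, Real.exp (-(Real.pi * t * ((n : ℝ) + 1 / 2) ^ 2))

/-- Jacobi's theta constant `θ₃` at the nome `exp (-π t)`. -/
noncomputable def thetaThree (t : ℝ) : ℝ := ∑' n : ℤ, Real.exp (-(Real.pi * t * (n : ℝ) ^ 2))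

/-- Jacobi's theta constant `θ₄` at the nome `exp (-π t)`. -/
noncomputable def thetaFour (t : ℝ) : ℝ :=
  ∑' n : ℤ, (-1) ^ n * Real.exp (-(Real.pi * t * (n : ℝ) ^ 2))

open Real

theorem summable_thetaTwo {t : ℝ} (ht : 0 < t) :
    Summable fun n : ℤ => exp (-(π * t * ((n : ℝ) + 1 / 2) ^ 2)) :=
  summable_exp_neg_mul_add_sq ht _

theorem summable_thetaThree {t : ℝ} (ht : 0 < t) :
    Summable fun n : ℤ => exp (-(π * t * (n : ℝ) ^ 2)) := by
  simpa using summable_exp_neg_mul_add_sq ht 0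

theorem summable_thetaFour {t : ℝ} (ht : 0 < t) :
    Summable fun n : ℤ => (-1) ^ n * exp (-(π * t * (n : ℝ) ^ 2)) := by
  refine Summable.of_norm ?_
  simpa [norm_mul, norm_zpow] using summable_thetaThree ht

theorem thetaTwo_pos {t : ℝ} (ht : 0 < t) : 0 < thetaTwo t :=
  (summable_thetaTwo ht).tsum_pos (fun _ => (exp_pos _).le) 0 (exp_pos _)

theorem thetaThree_pos {t : ℝ} (ht : 0 < t) : 0 < thetaThree t :=
  (summable_thetaThree ht).tsum_pos (fun _ => (exp_pos _).le) 0 (exp_pos _)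

/-- The sum of a function over a disjoint union of two injectively parametrized pieces. -/
theorem tsum_eq_add_of_parametrization {f : ℤ × ℤ → ℝ} (hf : Summable f) {g h : ℤ × ℤ → ℤ × ℤ}
    {P : ℤ × ℤ → Prop} (hg : Function.Injective g) (hh : Function.Injective h)
    (hgP : ∀ n, P n ↔ n ∈ Set.range g) (hhP : ∀ n, ¬ P n ↔ n ∈ Set.range h) :
    ∑' n, f n = ∑' n, f (g n) + ∑' n, f (h n) := by
  have hr : Set.range h = (Set.range g)ᶜ := by
    ext n
    rw [Set.mem_compl_iff, ← hgP, ← hhP]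
  have e := hf.tsum_subtype_add_tsum_subtype_compl (Set.range g)
  rw [← e, ← hr, tsum_range f hg, tsum_range f hh]

theorem tsum_eq_add_parity_fst {f : ℤ × ℤ → ℝ} (hf : Summable f) :
    ∑' n, f n = ∑' n : ℤ × ℤ, f (2 * n.1, n.2) + ∑' n : ℤ × ℤ, f (2 * n.1 + 1, n.2) := by
  refine tsum_eq_add_of_parametrization hf (P := fun n => n.1 % 2 = 0)
    (g := fun n : ℤ × ℤ => (2 * n.1, n.2)) (h := fun n : ℤ × ℤ => (2 * n.1 + 1, n.2)) ?_ ?_ ?_ ?_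
  · rintro ⟨a, b⟩ ⟨c, d⟩ h
    simp only [Prod.mk.injEq] at h ⊢
    omega
  · rintro ⟨a, b⟩ ⟨c, d⟩ h
    simp only [Prod.mk.injEq] at h ⊢
    omega
  · rintro ⟨a, b⟩
    refine ⟨fun h => ⟨(a / 2, b), ?_⟩, ?_⟩
    · simp only [Prod.mk.injEq, and_true] at h ⊢; omega
    · rintro ⟨⟨c, d⟩, h⟩; simp only [Prod.mk.injEq] at h ⊢; omega
  · rintro ⟨a, b⟩
    refine ⟨fun h => ⟨(a / 2, b), ?_⟩, ?_⟩
    · simp only [Prod.mk.injEq, and_true] at h ⊢; omega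
    · rintro ⟨⟨c, d⟩, h⟩; simp only [Prod.mk.injEq] at h ⊢; omega

theorem tsum_eq_add_parity_snd {f : ℤ × ℤ → ℝ} (hf : Summable f) :
    ∑' n, f n = ∑' n : ℤ × ℤ, f (n.1, 2 * n.2) + ∑' n : ℤ × ℤ, f (n.1, 2 * n.2 + 1) := by
  have h := tsum_eq_add_parity_fst ((Equiv.prodComm ℤ ℤ).summable_iff.2 hf)
  rw [← (Equiv.prodComm ℤ ℤ).tsum_eq f,
    ← (Equiv.prodComm ℤ ℤ).tsum_eq fun n : ℤ × ℤ => f (n.1, 2 * n.2),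
    ← (Equiv.prodComm ℤ ℤ).tsum_eq fun n : ℤ × ℤ => f (n.1, 2 * n.2 + 1)]
  exact h

theorem tsum_eq_add_parity_sum {f : ℤ × ℤ → ℝ} (hf : Summable f) :
    ∑' n, f n = ∑' n : ℤ × ℤ, f (n.1 + n.2, n.1 - n.2) +
      ∑' n : ℤ × ℤ, f (n.1 + n.2 + 1, n.1 - n.2) := by
  refine tsum_eq_add_of_parametrization hf (P := fun n => (n.1 + n.2) % 2 = 0)
    (g := fun n : ℤ × ℤ => (n.1 + n.2, n.1 - n.2))
    (h := fun n : ℤ × ℤ => (n.1 + n.2 + 1, n.1 - n.2)) ?_ ?_ ?_ ?_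
  · rintro ⟨a, b⟩ ⟨c, d⟩ h
    simp only [Prod.mk.injEq] at h ⊢
    omega
  · rintro ⟨a, b⟩ ⟨c, d⟩ h
    simp only [Prod.mk.injEq] at h ⊢
    omega
  · rintro ⟨a, b⟩
    refine ⟨fun h => ⟨((a + b) / 2, (a - b) / 2), ?_⟩, ?_⟩
    · simp only [Prod.mk.injEq] at h ⊢; omega
    · rintro ⟨⟨c, d⟩, h⟩; simp only [Prod.mk.injEq] at h ⊢; omega
  · rintro ⟨a, b⟩
    refine ⟨fun h => ⟨((a + b) / 2, (a - b) / 2), ?_⟩, ?_⟩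
    · simp only [Prod.mk.injEq] at h ⊢; omega
    · rintro ⟨⟨c, d⟩, h⟩; simp only [Prod.mk.injEq] at h ⊢; omega

theorem tsum_mul_tsum_int {f g : ℤ → ℝ} (hf : Summable f) (hg : Summable g) :
    Summable (fun n : ℤ × ℤ => f n.1 * g n.2) ∧
      (∑' n, f n) * ∑' n, g n = ∑' n : ℤ × ℤ, f n.1 * g n.2 := by
  have h := summable_mul_of_summable_norm hf.norm hg.norm
  exact ⟨h, hf.tsum_mul_tsum hg h⟩

theorem neg_one_zpow_add_eq_sub (i j : ℤ) : (-1 : ℝ) ^ (i + j) = (-1) ^ (i - j) := by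
  rw [show i + j = (i - j) + 2 * j by ring, zpow_add₀ (by norm_num), zpow_mul]
  norm_num

/-- The terms of n and -1 - n cancel. -/
theorem tsum_neg_one_zpow_mul_exp_half (t : ℝ) :
    ∑' n : ℤ, (-1 : ℝ) ^ n * exp (-(π * t * ((n : ℝ) + 1 / 2) ^ 2)) = 0 := by
  have h : ∑' n : ℤ, (-1 : ℝ) ^ n * exp (-(π * t * ((n : ℝ) + 1 / 2) ^ 2)) =
      -∑' n : ℤ, (-1 : ℝ) ^ n * exp (-(π * t * ((n : ℝ) + 1 / 2) ^ 2)) := by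
    conv_lhs => rw [← (Equiv.subLeft (-1 : ℤ)).tsum_eq]
    rw [← tsum_neg]
    refine tsum_congr fun n => ?_
    rw [Equiv.subLeft_apply, sub_eq_add_neg, zpow_add₀ (by norm_num), zpow_neg, ← inv_zpow]
    push_cast
    have : ((-1 : ℝ) ^ n)⁻¹ = (-1) ^ n := by rw [← inv_zpow]; norm_num
    norm_num [this]
    ring_nf
    simp
  linarith

variable {t : ℝ}

/-- On pairs of equal parity put (a + b, a - b), whose squares sum to 2(a² + b²); pairs of opposite
parity give the same with half-integers. The other duplication formulas use the same splitting. -/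
theorem thetaThree_sq (ht : 0 < t) :
    thetaThree t ^ 2 = thetaThree (2 * t) ^ 2 + thetaTwo (2 * t) ^ 2 := by
  have h2t : 0 < 2 * t := by linarith
  obtain ⟨hs, he⟩ := tsum_mul_tsum_int (summable_thetaThree ht) (summable_thetaThree ht)
  rw [sq, sq, sq, thetaThree, thetaThree, thetaTwo, he, tsum_eq_add_parity_sum hs,
    (tsum_mul_tsum_int (summable_thetaThree h2t) (summable_thetaThree h2t)).2,
    (tsum_mul_tsum_int (summable_thetaTwo h2t) (summable_thetaTwo h2t)).2]
  congr 1 <;> refine tsum_congr fun n => ?_ <;> rw [← exp_add, ← exp_add] <;> congr 1 <;>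
    push_cast <;> ring

theorem thetaFour_sq (ht : 0 < t) :
    thetaFour t ^ 2 = thetaThree (2 * t) ^ 2 - thetaTwo (2 * t) ^ 2 := by
  have h2t : 0 < 2 * t := by linarith
  obtain ⟨hs, he⟩ := tsum_mul_tsum_int (summable_thetaFour ht) (summable_thetaFour ht)
  have hsgn : ∀ i j : ℤ, (-1 : ℝ) ^ (i + j) * (-1) ^ (i - j) = 1 := fun i j => by
    rw [neg_one_zpow_add_eq_sub, ← zpow_add₀ (by norm_num), ← two_mul, zpow_mul]
    norm_num
  have hsgn' : ∀ i j : ℤ, (-1 : ℝ) ^ (i + j + 1) * (-1) ^ (i - j) = -1 := fun i j => by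
    rw [zpow_add_one₀ (by norm_num), mul_right_comm, hsgn]
    norm_num
  rw [sq, sq, sq, thetaFour, thetaThree, thetaTwo, he, tsum_eq_add_parity_sum hs,
    (tsum_mul_tsum_int (summable_thetaThree h2t) (summable_thetaThree h2t)).2,
    (tsum_mul_tsum_int (summable_thetaTwo h2t) (summable_thetaTwo h2t)).2, sub_eq_add_neg,
    ← tsum_neg]
  simp_rw [mul_mul_mul_comm, hsgn, hsgn', one_mul, neg_one_mul]
  congr 1 <;> refine tsum_congr fun n => ?_ <;> rw [← exp_add, ← exp_add] <;> congr 1 <;>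
    push_cast <;> ring_nf

theorem thetaThree_mul_thetaFour (ht : 0 < t) :
    thetaThree t * thetaFour t = thetaFour (2 * t) ^ 2 := by
  have h2t : 0 < 2 * t := by linarith
  obtain ⟨hs, he⟩ := tsum_mul_tsum_int (summable_thetaThree ht) (summable_thetaFour ht)
  have hs2 : Summable fun n : ℤ => (-1 : ℝ) ^ n * exp (-(π * (2 * t) * ((n : ℝ) + 1 / 2) ^ 2)) := by
    refine Summable.of_norm ?_
    simpa [norm_mul, norm_zpow] using summable_thetaTwo h2t
  rw [sq, thetaFour, thetaThree, thetaFour, he, tsum_eq_add_parity_sum hs,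
    (tsum_mul_tsum_int (summable_thetaFour h2t) (summable_thetaFour h2t)).2]
  have key : ∀ {a b c d e f : ℝ}, c * d = e * f → c * (a * b * d) = a * e * (b * f) :=
    fun {a b c d e f} h => by linear_combination (a * b) * h
  have h0 : ∑' n : ℤ × ℤ, (-1 : ℝ) ^ n.1 * exp (-(π * (2 * t) * ((n.1 : ℝ) + 1 / 2) ^ 2)) *
      ((-1 : ℝ) ^ n.2 * exp (-(π * (2 * t) * ((n.2 : ℝ) + 1 / 2) ^ 2))) = 0 := by
    rw [← (tsum_mul_tsum_int hs2 hs2).2, tsum_neg_one_zpow_mul_exp_half, zero_mul]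
  have h1 : ∑' n : ℤ × ℤ, exp (-(π * t * ((n.1 + n.2 + 1 : ℤ) : ℝ) ^ 2)) *
      ((-1 : ℝ) ^ (n.1 - n.2) * exp (-(π * t * ((n.1 - n.2 : ℤ) : ℝ) ^ 2))) = 0 := by
    rw [← h0]
    refine tsum_congr fun n => ?_
    rw [← neg_one_zpow_add_eq_sub, zpow_add₀ (by norm_num)]
    refine key ?_
    rw [← exp_add, ← exp_add]
    congr 1
    push_cast
    ring
  rw [h1, add_zero]
  refine tsum_congr fun n => ?_
  rw [← neg_one_zpow_add_eq_sub, zpow_add₀ (by norm_num)]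
  refine key ?_
  rw [← exp_add, ← exp_add]
  congr 1
  push_cast
  ring

theorem thetaTwo_sq (ht : 0 < t) : thetaTwo t ^ 2 = 2 * thetaTwo (2 * t) * thetaThree (2 * t) := by
  have h2t : 0 < 2 * t := by linarith
  obtain ⟨hs, he⟩ := tsum_mul_tsum_int (summable_thetaTwo ht) (summable_thetaTwo ht)
  have h1 : thetaTwo (2 * t) * thetaThree (2 * t) = _ :=
    (tsum_mul_tsum_int (summable_thetaTwo h2t) (summable_thetaThree h2t)).2
  have h2 : thetaThree (2 * t) * thetaTwo (2 * t) = _ :=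
    (tsum_mul_tsum_int (summable_thetaThree h2t) (summable_thetaTwo h2t)).2
  have h3 : 2 * thetaTwo (2 * t) * thetaThree (2 * t) = thetaTwo (2 * t) * thetaThree (2 * t) +
    thetaThree (2 * t) * thetaTwo (2 * t) := by ring
  rw [h3, h1, h2, sq, thetaTwo, he, tsum_eq_add_parity_sum hs,
    ← ((Equiv.addRight (1 : ℤ)).prodCongr (Equiv.refl ℤ)).tsum_eq fun n : ℤ × ℤ =>
      exp (-(π * (2 * t) * (n.1 : ℝ) ^ 2)) * exp (-(π * (2 * t) * ((n.2 : ℝ) + 1 / 2) ^ 2))]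
  congr 1 <;> refine tsum_congr fun n => ?_ <;> rw [← exp_add, ← exp_add] <;> congr 1 <;>
    simp <;> ring

/-- Jacobi's identity `θ₃⁴ = θ₂⁴ + θ₄⁴`. -/
theorem thetaThree_pow_four (ht : 0 < t) :
    thetaThree t ^ 4 = thetaTwo t ^ 4 + thetaFour t ^ 4 := by
  have h3 := thetaThree_sq ht
  have h4 := thetaFour_sq ht
  have h2 := thetaTwo_sq ht
  have e : ∀ a : ℝ, a ^ 4 = (a ^ 2) ^ 2 := fun a => by ring
  rw [e (thetaThree t), e (thetaTwo t), e (thetaFour t), h2, h3, h4]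
  ring

theorem thetaThree_inv (ht : 0 < t) : thetaThree t = (√t)⁻¹ * thetaThree t⁻¹ := by
  have h := tsum_gaussian_mul_exp' ht 0
  rw [← Complex.ofReal_inj]
  simp only [thetaThree, Complex.ofReal_mul, Complex.ofReal_tsum]
  simpa [div_eq_mul_inv] using h

theorem thetaFour_eq_thetaTwo_inv (ht : 0 < t) : thetaFour t = (√t)⁻¹ * thetaTwo t⁻¹ := by
  have h := tsum_gaussian_mul_exp' ht (1 / 2)
  have e : ∀ n : ℤ, Complex.exp (2 * π * Complex.I * (n * (1 / 2 : ℝ))) = (-1) ^ n := fun n => by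
    rw [← Complex.exp_pi_mul_I, ← Complex.exp_int_mul]
    congr 1
    push_cast
    ring
  simp_rw [e] at h
  rw [← Complex.ofReal_inj]
  simp only [thetaFour, thetaTwo, Complex.ofReal_mul, Complex.ofReal_tsum]
  simpa [div_eq_mul_inv, mul_comm] using h

theorem thetaFour_pos (ht : 0 < t) : 0 < thetaFour t := by
  rw [thetaFour_eq_thetaTwo_inv ht]
  have := thetaTwo_pos (inv_pos.2 ht)
  positivity

end

/-! ### The cubic theta function at the third singular value. -/

section

open Real
variable {t : ℝ}
/-- The Gaussian with parameter `t` of the norm form of the hexagonal lattice. -/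
noncomputable def hexExp (t : ℝ) (n : ℤ × ℤ) : ℝ :=
  exp (-(π * t * ((n.1 : ℝ) ^ 2 + n.1 * n.2 + (n.2 : ℝ) ^ 2)))

theorem summable_hexExp (ht : 0 < t) : Summable (hexExp t) := by
  have h := summable_hexForm ht 0 0
  simp only [add_zero] at h
  exact h

theorem injective_hexEven : Function.Injective fun n : ℤ × ℤ => (n.1, 2 * n.2) := by
  rintro ⟨a, b⟩ ⟨c, d⟩ h
  simp only [Prod.mk.injEq] at h ⊢
  omega

theorem injective_hexOdd : Function.Injective fun n : ℤ × ℤ => (n.1, 2 * n.2 + 1) := by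
  rintro ⟨a, b⟩ ⟨c, d⟩ h
  simp only [Prod.mk.injEq] at h ⊢
  omega

/-- The shear `(k, j) ↦ (k + j, j)`. -/
def intShear : ℤ × ℤ ≃ ℤ × ℤ where
  toFun n := (n.1 + n.2, n.2)
  invFun n := (n.1 - n.2, n.2)
  left_inv n := by ext <;> simp
  right_inv n := by ext <;> simp

theorem thetaThree_mul_thetaThree_three (ht : 0 < t) :
    thetaThree t * thetaThree (3 * t) = ∑' n : ℤ × ℤ, hexExp t (n.1, 2 * n.2) := by
  rw [thetaThree, thetaThree, (tsum_mul_tsum_int (summable_thetaThree ht)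
    (summable_thetaThree (by linarith))).2, ← intShear.tsum_eq]
  refine tsum_congr fun n => ?_
  rw [← exp_add, hexExp]
  congr 1
  simp only [intShear, Equiv.coe_fn_mk]
  push_cast
  ring

theorem thetaTwo_mul_thetaTwo_three (ht : 0 < t) :
    thetaTwo t * thetaTwo (3 * t) = ∑' n : ℤ × ℤ, hexExp t (n.1, 2 * n.2 + 1) := by
  rw [thetaTwo, thetaTwo, (tsum_mul_tsum_int (summable_thetaTwo ht)
    (summable_thetaTwo (by linarith))).2, ← intShear.tsum_eq]
  refine tsum_congr fun n => ?_
  rw [← exp_add, hexExp]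
  congr 1
  simp only [intShear, Equiv.coe_fn_mk]
  push_cast
  ring

theorem thetaFour_mul_thetaFour_three (ht : 0 < t) :
    thetaFour t * thetaFour (3 * t) = ∑' n : ℤ × ℤ, (-1) ^ n.1 * hexExp t (n.1, 2 * n.2) := by
  rw [thetaFour, thetaFour, (tsum_mul_tsum_int (summable_thetaFour ht)
    (summable_thetaFour (by linarith))).2, ← intShear.tsum_eq]
  refine tsum_congr fun n => ?_
  rw [mul_mul_mul_comm, ← exp_add, hexExp]
  simp only [intShear, Equiv.coe_fn_mk]
  rw [← zpow_add₀ (by norm_num), show n.1 + n.2 + n.2 = n.1 + 2 * n.2 by ring,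
    zpow_add₀ (by norm_num), zpow_mul (-1 : ℝ) 2]
  norm_num
  ring_nf
  simp

theorem tsum_hexExp (ht : 0 < t) :
    ∑' n, hexExp t n = thetaThree t * thetaThree (3 * t) + thetaTwo t * thetaTwo (3 * t) := by
  rw [thetaThree_mul_thetaThree_three ht, thetaTwo_mul_thetaTwo_three ht]
  exact tsum_eq_add_parity_snd (summable_hexExp ht)

/-- The affine map `(a, b) ↦ (-a - b - 1, a)`, the rotation by `2π / 3` on the nonzero classes
modulo two. -/
def oddClassRotation : ℤ × ℤ ≃ ℤ × ℤ where
  toFun n := (-n.1 - n.2 - 1, n.1)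
  invFun n := (n.2, -n.1 - n.2 - 1)
  left_inv n := by ext <;> simp; ring
  right_inv n := by ext <;> simp; ring

/-- The modular equation of degree three. -/
theorem thetaThree_mul_sub_thetaFour_mul (ht : 0 < t) :
    thetaThree t * thetaThree (3 * t) - thetaFour t * thetaFour (3 * t) =
      thetaTwo t * thetaTwo (3 * t) := by
  have hs := summable_hexExp ht
  have he := hs.comp_injective injective_hexEven
  have ho := hs.comp_injective injective_hexOdd
  have hn : Summable fun n : ℤ × ℤ => (-1) ^ n.1 * hexExp t (n.1, 2 * n.2) := by
    refine Summable.of_norm ?_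
    simpa [norm_mul, norm_zpow] using he.norm
  -- The three nonzero classes modulo 2 are permuted by symmetries of the form, so they carry equal
  -- sums; each side of the equation is twice this sum.
  have e1 : ∑' n : ℤ × ℤ, hexExp t (2 * n.1 + 1, 2 * n.2 + 1) =
      ∑' n : ℤ × ℤ, hexExp t (2 * n.1 + 1, 2 * n.2) := by
    rw [← oddClassRotation.tsum_eq]
    refine tsum_congr fun n => ?_
    rw [hexExp, hexExp]
    congr 1
    simp only [oddClassRotation, Equiv.coe_fn_mk]
    push_cast
    ring
  have e2 : ∑' n : ℤ × ℤ, hexExp t (2 * n.1, 2 * n.2 + 1) =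
      ∑' n : ℤ × ℤ, hexExp t (2 * n.1 + 1, 2 * n.2) := by
    rw [← (Equiv.prodComm ℤ ℤ).tsum_eq]
    refine tsum_congr fun n => ?_
    rw [hexExp, hexExp]
    congr 1
    simp only [Equiv.prodComm_apply, Prod.swap]
    push_cast
    ring
  have h3 := tsum_eq_add_parity_fst he
  have h4 := tsum_eq_add_parity_fst hn
  have h2 := tsum_eq_add_parity_fst ho
  simp only [Function.comp_def] at h3 h4 h2
  have z1 : ∀ n : ℤ, (-1 : ℝ) ^ (2 * n) = 1 := fun n => by rw [zpow_mul]; norm_num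
  have z2 : ∀ n : ℤ, (-1 : ℝ) ^ (2 * n + 1) = -1 := fun n => by
    rw [zpow_add_one₀ (by norm_num), z1]; norm_num
  simp only [z1, z2, one_mul, neg_one_mul, tsum_neg] at h4
  rw [thetaThree_mul_thetaThree_three ht, thetaTwo_mul_thetaTwo_three ht,
    thetaFour_mul_thetaFour_three ht, h2, h3, h4, e1, e2]
  ring

theorem hexGaussian_eq_hexExp (n : ℤ × ℤ) : hexGaussian n.1 n.2 = hexExp (2 / √3) n := rfl

theorem sqrt_sqrt_three_sq : √√3 ^ 2 = √3 := Real.sq_sqrt (Real.sqrt_nonneg 3)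

theorem sqrt_three_inv : (√3)⁻¹ = √3 / 3 := by
  have h3 : √3 ^ 2 = (3 : ℝ) := Real.sq_sqrt (by norm_num)
  field_simp
  linarith

theorem sqrt_inv_sqrt_three : (√(√3)⁻¹)⁻¹ = √√3 := by rw [Real.sqrt_inv, inv_inv]

theorem thetaThree_inv_sqrt_three : thetaThree (√3)⁻¹ = √√3 * thetaThree √3 := by
  rw [thetaThree_inv (by positivity), sqrt_inv_sqrt_three, inv_inv]

theorem thetaFour_inv_sqrt_three : thetaFour (√3)⁻¹ = √√3 * thetaTwo √3 := by
  rw [thetaFour_eq_thetaTwo_inv (by positivity), sqrt_inv_sqrt_three, inv_inv]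

theorem thetaTwo_inv_sqrt_three : thetaTwo (√3)⁻¹ = √√3 * thetaFour √3 := by
  rw [thetaFour_eq_thetaTwo_inv (by positivity)]
  field_simp

/-- At t = 1/√3, tripling and inversion both lead to √3, so the modular equation becomes a relation
at a single point. -/
theorem thetaThree_sqrt_three_sq : thetaThree √3 ^ 2 = 2 * (thetaTwo √3 * thetaFour √3) := by
  have h := thetaThree_mul_sub_thetaFour_mul (t := (√3)⁻¹) (by positivity)
  have e : 3 * (√3)⁻¹ = √3 := by rw [sqrt_three_inv]; ring
  rw [e, thetaThree_inv_sqrt_three, thetaFour_inv_sqrt_three, thetaTwo_inv_sqrt_three] at h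
  have h0 : 0 < √√3 := by positivity
  have : √√3 * thetaThree √3 ^ 2 = √√3 * (2 * (thetaTwo √3 * thetaFour √3)) := by linarith
  exact mul_left_cancel₀ h0.ne' this

/-- Needed to select a root of the quadratic below. By inversion it compares θ₂ at √3 and at 1/√3,
which can be done term by term. -/
theorem thetaTwo_sqrt_three_le_thetaFour : thetaTwo √3 ≤ thetaFour √3 := by
  have h0 : 0 < √√3 := by positivity
  have h : √√3 * thetaTwo √3 ≤ thetaTwo (√3)⁻¹ := by
    rw [thetaTwo, ← tsum_mul_left]
    refine ((summable_thetaTwo (by positivity)).mul_left _).tsum_le_tsum (fun n => ?_)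
      (summable_thetaTwo (by positivity))
    have h1 : √√3 ≤ exp (π * (√3 - (√3)⁻¹) * ((n : ℝ) + 1 / 2) ^ 2) := by
      have hs : √3 ≤ 1.75 := by
        rw [Real.sqrt_le_left (by norm_num)]; norm_num
      have hs' : 1.5 ≤ √3 := Real.le_sqrt_of_sq_le (by norm_num)
      have hss : √√3 ≤ 1.5 := by
        rw [Real.sqrt_le_left (by norm_num)]; norm_num; linarith
      have hn : 1 / 4 ≤ ((n : ℝ) + 1 / 2) ^ 2 := by
        have : (0 : ℝ) ≤ (n * (n + 1) : ℤ) := by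
          exact_mod_cast (by rcases le_or_gt 0 n with h | h <;> nlinarith : 0 ≤ n * (n + 1))
        push_cast at this
        linarith
      have hx : 1 / 2 ≤ π * (√3 - (√3)⁻¹) * ((n : ℝ) + 1 / 2) ^ 2 := by
        have : 3 ≤ π * (√3 - (√3)⁻¹) := by
          rw [sqrt_three_inv]
          nlinarith [pi_gt_three]
        nlinarith
      linarith [add_one_le_exp (π * (√3 - (√3)⁻¹) * ((n : ℝ) + 1 / 2) ^ 2)]
    refine (mul_le_mul_of_nonneg_right h1 (exp_pos _).le).trans_eq ?_
    rw [← exp_add]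
    congr 1
    ring
  rw [thetaTwo_inv_sqrt_three] at h
  exact le_of_mul_le_mul_left h h0

/-- The fourth power of `θ₄ / θ₃` at the third singular value. -/
theorem thetaFour_sqrt_three_pow_four :
    thetaFour √3 ^ 4 = (2 + √3) / 4 * thetaThree √3 ^ 4 := by
  have h3 : √3 ^ 2 = (3 : ℝ) := Real.sq_sqrt (by norm_num)
  have hpos : 0 < √3 := by positivity
  have hJ := thetaThree_pow_four hpos
  have hm := thetaThree_sqrt_three_sq
  have hle := pow_le_pow_left₀ (thetaTwo_pos hpos).le thetaTwo_sqrt_three_le_thetaFour 4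
  have h4 : thetaThree √3 ^ 4 * thetaThree √3 ^ 4 =
      16 * (thetaTwo √3 ^ 4 * thetaFour √3 ^ 4) := by
    calc _ = (thetaThree √3 ^ 2) ^ 4 := by ring
      _ = _ := by rw [hm]; ring
  have hT := pow_pos (thetaThree_pos hpos) 4
  set T := thetaThree √3 ^ 4
  set W := thetaFour √3 ^ 4
  have hfac : (W - (2 + √3) / 4 * T) * (W - (2 - √3) / 4 * T) = 0 := by
    -- Jacobi's identity eliminates θ₂⁴ and leaves T² = 16W(T - W); the root with 2 - √3 would
    -- violate θ₂⁴ ≤ θ₄⁴.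
    have : thetaTwo √3 ^ 4 = T - W := by linarith
    rw [this] at h4
    linear_combination (1 / 16) * h4 - T ^ 2 / 16 * h3
  rcases mul_eq_zero.1 hfac with h | h
  · linarith
  · nlinarith

/-- The cubic theta function at the self-dual nome, through the third singular value. -/
theorem tsum_hexGaussian_sq :
    (∑' n : ℤ × ℤ, hexGaussian n.1 n.2) ^ 2 = 3 * √3 / 4 * thetaThree √3 ^ 4 := by
  have hpos : 0 < √3 := by positivity
  have hipos : 0 < (√3)⁻¹ := by positivity
  have e : 3 * (2 / √3) = 2 * √3 := by
    rw [div_eq_mul_inv, sqrt_three_inv]; ring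
  have e2 : 2 / √3 = 2 * (√3)⁻¹ := by rw [div_eq_mul_inv]
  simp_rw [hexGaussian_eq_hexExp]
  have a1 := thetaThree_sq hipos
  have a2 := thetaFour_sq hipos
  have a3 := thetaTwo_sq hipos
  have b1 := thetaThree_sq hpos
  have b2 := thetaFour_sq hpos
  have b3 := thetaTwo_sq hpos
  have hJ := thetaThree_pow_four hpos
  have hm := thetaThree_sqrt_three_sq
  rw [thetaThree_inv_sqrt_three, mul_pow, sqrt_sqrt_three_sq] at a1
  rw [thetaFour_inv_sqrt_three, mul_pow, sqrt_sqrt_three_sq] at a2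
  rw [thetaTwo_inv_sqrt_three, mul_pow, sqrt_sqrt_three_sq] at a3
  rw [tsum_hexExp (by positivity), e, e2]
  set A := thetaThree (2 * (√3)⁻¹)
  set B := thetaTwo (2 * (√3)⁻¹)
  set C := thetaThree (2 * √3)
  set D := thetaTwo (2 * √3)
  set T3 := thetaThree √3
  set T2 := thetaTwo √3
  set T4 := thetaFour √3
  have hA : A ^ 2 = √3 * (T3 ^ 2 + T2 ^ 2) / 2 := by linarith
  have hB : B ^ 2 = √3 * (T3 ^ 2 - T2 ^ 2) / 2 := by linarith
  have hC : C ^ 2 = (T3 ^ 2 + T4 ^ 2) / 2 := by linarith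
  have hD : D ^ 2 = (T3 ^ 2 - T4 ^ 2) / 2 := by linarith
  have hm2 : T3 ^ 4 = 4 * (T2 ^ 2 * T4 ^ 2) := by
    calc T3 ^ 4 = (T3 ^ 2) ^ 2 := by ring
      _ = _ := by rw [hm]; ring
  -- The cross term is a product of two θ₂ duplications, so the square is polynomial in the values
  -- at √3.
  calc (A * C + B * D) ^ 2 = A ^ 2 * C ^ 2 + B ^ 2 * D ^ 2 + (2 * B * A) * (2 * D * C) / 2 := by
        ring
    _ = _ := by
      rw [hA, hB, hC, hD, ← a3, ← b3]
      linear_combination (-(√3) / 4) * hm2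

open Filter Topology in
theorem tendsto_exp_neg_mul_int_sq (n : ℤ) :
    Tendsto (fun t : ℝ => exp (-(π * t * (n : ℝ) ^ 2))) atTop (𝓝 (if n = 0 then 1 else 0)) := by
  split_ifs with h
  · simp [h]
  · refine tendsto_exp_neg_atTop_nhds_zero.comp ?_
    have hn : 0 < π * (n : ℝ) ^ 2 := by positivity
    refine (tendsto_id.const_mul_atTop hn).congr fun t => ?_
    simp only [id]
    ring

theorem exp_neg_mul_int_sq_le (ht : 1 ≤ t) (n : ℤ) :
    exp (-(π * t * (n : ℝ) ^ 2)) ≤ exp (-(π * 1 * (n : ℝ) ^ 2)) := by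
  gcongr

open Filter Topology in
theorem tendsto_thetaThree : Tendsto thetaThree atTop (𝓝 1) := by
  have h := tendsto_tsum_of_dominated_convergence (𝓕 := atTop)
    (summable_thetaThree one_pos) tendsto_exp_neg_mul_int_sq ?_
  · rwa [tsum_ite_eq] at h
  · filter_upwards [eventually_ge_atTop 1] with t ht n
    rw [Real.norm_of_nonneg (exp_pos _).le]
    exact exp_neg_mul_int_sq_le ht n

open Filter Topology in
theorem tendsto_thetaFour : Tendsto thetaFour atTop (𝓝 1) := by
  have h := tendsto_tsum_of_dominated_convergence (𝓕 := atTop)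
    (f := fun (t : ℝ) (n : ℤ) => (-1 : ℝ) ^ n * exp (-(π * t * (n : ℝ) ^ 2)))
    (summable_thetaThree one_pos) (fun n => (tendsto_exp_neg_mul_int_sq n).const_mul _) ?_
  · have e : ∀ n : ℤ, (-1 : ℝ) ^ n * (if n = 0 then 1 else 0) = if n = 0 then 1 else 0 :=
      fun n => by split_ifs with h <;> simp [h]
    simp_rw [e, tsum_ite_eq] at h
    exact h
  · filter_upwards [eventually_ge_atTop 1] with t ht n
    rw [norm_mul, norm_zpow, norm_neg, norm_one, one_zpow, one_mul,
      Real.norm_of_nonneg (exp_pos _).le]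
    exact exp_neg_mul_int_sq_le ht n

end

/-! ### Landen's transformation and the evaluation of θ₃ by Gamma values. -/

section

open Real MeasureTheory Set Filter Topology

theorem image_sub_div_Ioi {r : ℝ} (hr : 0 < r) : (fun u : ℝ => (u - r / u) / 2) '' Ioi 0 = univ := by
  refine eq_univ_of_forall fun t => ?_
  have h0 : |t| < √(t ^ 2 + r) := by
    rw [← Real.sqrt_sq_eq_abs]
    exact Real.sqrt_lt_sqrt (sq_nonneg t) (by linarith)
  have hu : 0 < t + √(t ^ 2 + r) := by linarith [neg_abs_le t]
  have hsq : √(t ^ 2 + r) ^ 2 = t ^ 2 + r := Real.sq_sqrt (by positivity)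
  refine ⟨t + √(t ^ 2 + r), hu, ?_⟩
  simp only
  field_simp
  linarith

theorem injOn_sub_div_Ioi {r : ℝ} (hr : 0 < r) : InjOn (fun u : ℝ => (u - r / u) / 2) (Ioi 0) := by
  have : StrictMonoOn (fun u : ℝ => (u - r / u) / 2) (Ioi 0) := by
    intro a ha b hb hab
    have := div_lt_div_of_pos_left hr ha hab
    simp only
    linarith
  exact this.injOn

/-- Landen's transformation. -/
theorem integral_landen {p r : ℝ} (hr : 0 < r) :
    ∫ u in Ioi (0 : ℝ), (√(u ^ 4 + p * u ^ 2 + r ^ 2))⁻¹ =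
      ∫ u in Ioi (0 : ℝ), (√((u ^ 2 + r) * (u ^ 2 + (p + 2 * r) / 4)))⁻¹ := by
  set g : ℝ → ℝ := fun t => (√((t ^ 2 + r) * (t ^ 2 + (p + 2 * r) / 4)))⁻¹ with hg
  have h1 : ∫ t, g t = 2 * ∫ t in Ioi (0 : ℝ), g t := by
    rw [← integral_comp_abs]
    simp [hg]
  have hd : ∀ u ∈ Ioi (0 : ℝ), HasDerivWithinAt (fun u : ℝ => (u - r / u) / 2)
      ((1 + r / u ^ 2) / 2) (Ioi 0) u := by
    intro u hu
    have hu0 : u ≠ 0 := (mem_Ioi.1 hu).ne'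
    have h := (((hasDerivAt_id u).sub ((hasDerivAt_inv hu0).const_mul r)).div_const 2)
    refine (h.congr_deriv ?_).hasDerivWithinAt
    field_simp
    ring
  have h2 := integral_image_eq_integral_abs_deriv_smul measurableSet_Ioi hd (injOn_sub_div_Ioi hr) g
  rw [image_sub_div_Ioi hr, Measure.restrict_univ] at h2
  have h3 : ∫ u in Ioi (0 : ℝ), |(1 + r / u ^ 2) / 2| • g ((u - r / u) / 2) =
      ∫ u in Ioi (0 : ℝ), 2 * (√(u ^ 4 + p * u ^ 2 + r ^ 2))⁻¹ := by
    refine setIntegral_congr_fun measurableSet_Ioi fun u hu => ?_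
    have hu0 : 0 < u := hu
    simp only [hg, smul_eq_mul]
    -- For t = (u - r/u)/2, the factor t² + r is the square of (u + r/u)/2, which cancels against
    -- the Jacobian.
    have e : (((u - r / u) / 2) ^ 2 + r) * (((u - r / u) / 2) ^ 2 + (p + 2 * r) / 4) =
        ((u ^ 2 + r) / (4 * u ^ 2)) ^ 2 * (u ^ 4 + p * u ^ 2 + r ^ 2) := by
      field_simp
      ring
    rw [e, Real.sqrt_mul (sq_nonneg _), Real.sqrt_sq (by positivity), abs_of_pos (by positivity),
      mul_inv, ← mul_assoc]
    congr 1
    field_simp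
    ring
  rw [h1, h3, integral_const_mul] at h2
  linarith

/-- The complete elliptic integral in the form used for the arithmetic-geometric mean. -/
noncomputable def agmIntegral (a b : ℝ) : ℝ :=
  ∫ u in Ioi (0 : ℝ), (√((u ^ 2 + a ^ 2) * (u ^ 2 + b ^ 2)))⁻¹

/-- Landen with p = a² + b² and r = ab, for which (p + 2r)/4 is the square of the arithmetic mean.
-/
theorem agmIntegral_mean {a b c : ℝ} (ha : 0 < a) (hb : 0 < b) (hc : c ^ 2 = a * b) :
    agmIntegral a b = agmIntegral ((a + b) / 2) c := by
  have h := integral_landen (p := a ^ 2 + b ^ 2) (mul_pos ha hb)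
  rw [agmIntegral, agmIntegral]
  convert h using 5 with u u
  · ring
  · rw [hc]; ring

theorem tendsto_agmIntegral {ι : Type*} {l : Filter ι} [l.IsCountablyGenerated] {a b : ι → ℝ}
    (ha : Tendsto a l (𝓝 1)) (hb : Tendsto b l (𝓝 1)) :
    Tendsto (fun i => agmIntegral (a i) (b i)) l (𝓝 (π / 2)) := by
  have hlim : π / 2 = ∫ u in Ioi (0 : ℝ), (1 + u ^ 2)⁻¹ := by
    rw [integral_Ioi_inv_one_add_sq, arctan_zero, sub_zero]
  rw [hlim]
  refine tendsto_integral_filter_of_dominated_convergence (fun u => 4 * (1 + u ^ 2)⁻¹) ?_ ?_ ?_ ?_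
  · refine Eventually.of_forall fun i => Measurable.aestronglyMeasurable ?_
    fun_prop
  · filter_upwards [ha.eventually_const_lt (by norm_num : (1 / 2 : ℝ) < 1),
      hb.eventually_const_lt (by norm_num : (1 / 2 : ℝ) < 1)] with i hai hbi
    refine Eventually.of_forall fun u => ?_
    rw [Real.norm_of_nonneg (by positivity)]
    have h1 : (1 + u ^ 2) / 4 ≤ √((u ^ 2 + a i ^ 2) * (u ^ 2 + b i ^ 2)) := by
      refine Real.le_sqrt_of_sq_le ?_
      rw [sq]
      refine mul_le_mul ?_ ?_ (by positivity) (by positivity) <;> nlinarith [sq_nonneg u]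
    refine (inv_anti₀ (by positivity) h1).trans_eq ?_
    field_simp
  · exact (integrable_inv_one_add_sq.const_mul 4).integrableOn
  · refine Eventually.of_forall fun u => ?_
    have h1 : Tendsto (fun i => (u ^ 2 + a i ^ 2) * (u ^ 2 + b i ^ 2)) l
        (𝓝 ((u ^ 2 + 1 ^ 2) * (u ^ 2 + 1 ^ 2))) :=
      (tendsto_const_nhds.add (ha.pow 2)).mul (tendsto_const_nhds.add (hb.pow 2))
    have h2 := (h1.sqrt).inv₀ (by positivity)
    rw [Real.sqrt_mul_self (by positivity)] at h2
    convert h2 using 3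
    ring

/-- Doubling t performs one arithmetic-geometric mean step on (θ₃², θ₄²). The integral is thus
constant along 2ⁿt, where both entries tend to 1. -/
theorem agmIntegral_theta {t : ℝ} (ht : 0 < t) :
    agmIntegral (thetaThree t ^ 2) (thetaFour t ^ 2) = π / 2 := by
  have hstep : ∀ s : ℝ, 0 < s → agmIntegral (thetaThree s ^ 2) (thetaFour s ^ 2) =
      agmIntegral (thetaThree (2 * s) ^ 2) (thetaFour (2 * s) ^ 2) := fun s hs => by
    rw [agmIntegral_mean (pow_pos (thetaThree_pos hs) 2) (pow_pos (thetaFour_pos hs) 2)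
      (c := thetaFour (2 * s) ^ 2)]
    · congr 1
      rw [thetaThree_sq hs, thetaFour_sq hs]
      ring
    · rw [← thetaThree_mul_thetaFour hs]
      ring
  have hiter : ∀ n : ℕ, agmIntegral (thetaThree (2 ^ n * t) ^ 2) (thetaFour (2 ^ n * t) ^ 2) =
      agmIntegral (thetaThree t ^ 2) (thetaFour t ^ 2) := fun n => by
    induction n with
    | zero => simp
    | succ n ih => rw [pow_succ' 2 n, mul_assoc, ← hstep (2 ^ n * t) (by positivity), ih]
  have htend : Tendsto (fun n : ℕ => (2 : ℝ) ^ n * t) atTop atTop :=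
    (tendsto_pow_atTop_atTop_of_one_lt one_lt_two).atTop_mul_const ht
  have h3 := (tendsto_thetaThree.comp htend).pow 2
  have h4 := (tendsto_thetaFour.comp htend).pow 2
  rw [one_pow] at h3 h4
  have h := tendsto_agmIntegral h3 h4
  simp only [Function.comp_def, hiter] at h
  exact tendsto_nhds_unique tendsto_const_nhds h

theorem agmIntegral_mul {a b s : ℝ} (hs : 0 < s) :
    agmIntegral (s * a) (s * b) = s⁻¹ * agmIntegral a b := by
  rw [agmIntegral, agmIntegral, ← integral_const_mul]
  have h := integral_comp_mul_left_Ioi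
    (fun u : ℝ => (√((u ^ 2 + (s * a) ^ 2) * (u ^ 2 + (s * b) ^ 2)))⁻¹) 0 hs
  rw [mul_zero, smul_eq_mul] at h
  have e : ∫ u in Ioi (0 : ℝ), (√((u ^ 2 + (s * a) ^ 2) * (u ^ 2 + (s * b) ^ 2)))⁻¹ =
      s * ∫ u in Ioi (0 : ℝ), (√(((s * u) ^ 2 + (s * a) ^ 2) * ((s * u) ^ 2 + (s * b) ^ 2)))⁻¹ := by
    rw [h]
    field_simp
  rw [e, ← integral_const_mul]
  refine setIntegral_congr_fun measurableSet_Ioi fun u _ => ?_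
  have : ((s * u) ^ 2 + (s * a) ^ 2) * ((s * u) ^ 2 + (s * b) ^ 2) =
      (s ^ 2) ^ 2 * ((u ^ 2 + a ^ 2) * (u ^ 2 + b ^ 2)) := by ring
  rw [this, Real.sqrt_mul (by positivity), Real.sqrt_sq (by positivity), mul_inv, ← mul_assoc]
  congr 1
  field_simp

theorem integral_beta {a b : ℝ} (ha : 0 < a) (hb : 0 < b) :
    IntegrableOn (fun x : ℝ => x ^ (a - 1) * (1 - x) ^ (b - 1)) (Ioo 0 1) ∧
    ∫ x in Ioo (0 : ℝ) 1, x ^ (a - 1) * (1 - x) ^ (b - 1) = Gamma a * Gamma b / Gamma (a + b) := by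
  have hc := Complex.betaIntegral_convergent (u := a) (v := b) (by simpa) (by simpa)
  have he := Complex.betaIntegral_eq_Gamma_mul_div a b (by simpa) (by simpa)
  rw [intervalIntegrable_iff_integrableOn_Ioo_of_le zero_le_one] at hc
  rw [Complex.betaIntegral, intervalIntegral.integral_of_le zero_le_one,
    integral_Ioc_eq_integral_Ioo] at he
  have e : EqOn (fun x : ℝ => (x : ℂ) ^ ((a : ℂ) - 1) * (1 - (x : ℂ)) ^ ((b : ℂ) - 1))
      (fun x : ℝ => ((x ^ (a - 1) * (1 - x) ^ (b - 1) : ℝ) : ℂ)) (Ioo 0 1) := by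
    intro x hx
    simp only
    rw [Complex.ofReal_mul, Complex.ofReal_cpow hx.1.le, Complex.ofReal_cpow (by linarith [hx.2])]
    push_cast
    rfl
  constructor
  · have := (hc.congr_fun e measurableSet_Ioo).re
    rw [IntegrableOn]
    simpa using this
  · rw [setIntegral_congr_fun measurableSet_Ioo e, integral_complex_ofReal, Complex.Gamma_ofReal,
      Complex.Gamma_ofReal, ← Complex.ofReal_add, Complex.Gamma_ofReal] at he
    exact_mod_cast he

/-- The substitution (1 + √3u²)⁻³ works because (1 + √3u²)³ - 1 = 3√3u²(u⁴ + √3u² + 1). -/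
theorem integral_quartic_eq_beta :
    ∫ u in Ioi (0 : ℝ), (√(u ^ 4 + √3 * u ^ 2 + 1))⁻¹ =
      √√3 / 6 * (Gamma (1 / 6) * Gamma (1 / 2) / Gamma (1 / 6 + 1 / 2)) := by
  have h3 : √3 ^ 2 = (3 : ℝ) := Real.sq_sqrt (by norm_num)
  have hp3 : 0 < √3 := by positivity
  rw [← (integral_beta (a := 1 / 6) (b := 1 / 2) (by norm_num) (by norm_num)).2]
  set f : ℝ → ℝ := fun u => ((1 + √3 * u ^ 2) ^ 3)⁻¹ with hf
  have hx : ∀ u : ℝ, 0 < u → 1 < 1 + √3 * u ^ 2 := fun u hu => by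
    have : 0 < √3 * u ^ 2 := by positivity
    linarith
  have hd : ∀ u ∈ Ioi (0 : ℝ), HasDerivWithinAt f
      (-(3 * (2 * √3 * u)) / (1 + √3 * u ^ 2) ^ 4) (Ioi 0) u := by
    intro u hu
    have hx0 : (1 + √3 * u ^ 2) ≠ 0 := by positivity
    have h := ((((hasDerivAt_pow 2 u).const_mul √3).const_add 1).pow 3).inv (pow_ne_zero 3 hx0)
    refine (h.congr_deriv ?_).hasDerivWithinAt
    simp
    field_simp
  have hinj : InjOn f (Ioi 0) := by
    have : StrictAntiOn f (Ioi 0) := by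
      intro a ha b hb hab
      have ha' : 0 < a := ha
      simp only [hf]
      gcongr
    exact this.injOn
  have himg : f '' Ioi 0 = Ioo 0 1 := by
    ext y
    constructor
    · rintro ⟨u, hu, rfl⟩
      have hu' : 0 < u := hu
      refine ⟨by positivity, inv_lt_one_of_one_lt₀ (one_lt_pow₀ (hx u hu) (by norm_num))⟩
    · rintro ⟨hy0, hy1⟩
      have hz : 1 < y ^ (-(1 / 3) : ℝ) := Real.one_lt_rpow_of_pos_of_lt_one_of_neg hy0 hy1 (by norm_num)
      refine ⟨√((y ^ (-(1 / 3) : ℝ) - 1) / √3), Real.sqrt_pos.2 (div_pos (by linarith) hp3), ?_⟩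
      simp only [hf]
      rw [Real.sq_sqrt (div_nonneg (by linarith) hp3.le), mul_div_cancel₀ _ hp3.ne',
        add_sub_cancel, ← Real.rpow_natCast, ← Real.rpow_mul hy0.le, ← Real.rpow_neg hy0.le]
      norm_num
  rw [← himg, integral_image_eq_integral_abs_deriv_smul measurableSet_Ioi hd hinj,
    ← integral_const_mul]
  refine setIntegral_congr_fun measurableSet_Ioi fun u hu => ?_
  have hu0 : 0 < u := hu
  have hx1 := hx u hu0
  have hQ : 0 < u ^ 4 + √3 * u ^ 2 + 1 := by positivity
  simp only [smul_eq_mul, hf]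
  set x := 1 + √3 * u ^ 2 with hxdef
  have hx0 : 0 < x := by linarith
  have e1 : ((x ^ 3)⁻¹) ^ (1 / 6 - 1 : ℝ) = x ^ 2 * √x := by
    rw [← Real.rpow_natCast, ← Real.rpow_neg hx0.le, ← Real.rpow_mul hx0.le, Real.sqrt_eq_rpow,
      ← Real.rpow_natCast, ← Real.rpow_add hx0]
    norm_num
  have hcube : x ^ 3 - 1 = 3 * √3 * u ^ 2 * (u ^ 4 + √3 * u ^ 2 + 1) := by
    rw [hxdef]
    linear_combination (√3 * u ^ 6) * h3
  have e2 : (1 - (x ^ 3)⁻¹) ^ (1 / 2 - 1 : ℝ) =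
      x * √x / (√3 * √√3 * u * √(u ^ 4 + √3 * u ^ 2 + 1)) := by
    have : 1 - (x ^ 3)⁻¹ = (√3 * √√3 * u * √(u ^ 4 + √3 * u ^ 2 + 1)) ^ 2 / (x * √x) ^ 2 := by
      rw [mul_pow, mul_pow, mul_pow, mul_pow, sqrt_sqrt_three_sq, Real.sq_sqrt hQ.le, h3,
        Real.sq_sqrt hx0.le, ← hcube]
      field_simp
    rw [this, show (1 / 2 - 1 : ℝ) = -(1 / 2) by norm_num, Real.rpow_neg (by positivity),
      ← Real.sqrt_eq_rpow, Real.sqrt_div (by positivity), Real.sqrt_sq (by positivity),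
      Real.sqrt_sq (by positivity), inv_div]
  rw [e1, e2, abs_div, abs_neg, abs_of_pos (by positivity), abs_of_pos (by positivity)]
  have hsx : √x ^ 2 = x := Real.sq_sqrt hx0.le
  have : 0 < √(u ^ 4 + √3 * u ^ 2 + 1) := by positivity
  field_simp
  rw [hsx]
  ring

theorem thetaThree_sqrt_three_sq_mul :
    thetaThree √3 ^ 2 * (π / 2) = √√3 / 6 * (Gamma (1 / 6) * √π / Gamma (2 / 3)) := by
  have hpos : 0 < √3 := by positivity
  have hT := pow_pos (thetaThree_pos hpos) 2
  have h := agmIntegral_theta hpos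
  have hk : thetaFour √3 ^ 2 = thetaThree √3 ^ 2 * √((2 + √3) / 4) := by
    rw [← Real.sqrt_sq hT.le, ← Real.sqrt_mul (by positivity), ← Real.sqrt_sq
      (sq_nonneg (thetaFour √3))]
    congr 1
    have := thetaFour_sqrt_three_pow_four
    linarith
  rw [hk, ← mul_one (thetaThree √3 ^ 2), mul_assoc, one_mul, agmIntegral_mul hT] at h
  -- Landen read backwards: (√3 + 2)/4 is the squared modulus found for θ₄²/θ₃².
  have hl := integral_landen (p := √3) (r := 1) one_pos
  have e : agmIntegral 1 √((2 + √3) / 4) = ∫ u in Ioi (0 : ℝ), (√(u ^ 4 + √3 * u ^ 2 + 1))⁻¹ := by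
    rw [agmIntegral, Real.sq_sqrt (by positivity)]
    simp only [one_pow] at hl ⊢
    rw [hl]
    congr! 6
    ring
  rw [e, integral_quartic_eq_beta, Gamma_one_half_eq, show (1 / 6 + 1 / 2 : ℝ) = 2 / 3 by norm_num]
    at h
  have hT0 := (thetaThree_pos hpos).ne'
  rw [← h]
  field_simp

end

/-! ### The hypergeometric value at 1/2. -/

section

open Real MeasureTheory Set Filter Topology

theorem hasSum_ascPochhammer_mul_pow (a : ℝ) {x : ℝ} (hx : |x| < 1) :
    HasSum (fun n : ℕ => (ascPochhammer ℝ n).eval a / n.factorial * x ^ n) (1 / (1 - x) ^ a) := by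
  have h := (one_div_one_sub_rpow_hasFPowerSeriesOnBall_zero a).hasSum (y := x) (by
    simpa [enorm_eq_nnnorm, ← NNReal.coe_lt_coe] using hx)
  rw [zero_add] at h
  refine h.congr_fun fun n => ?_
  rw [FormalMultilinearSeries.ofScalars_apply_eq, smul_eq_mul, ← Ring.multichoose_eq]
  have h2 := Ring.factorial_nsmul_multichoose_eq_ascPochhammer a n
  rw [Polynomial.ascPochhammer_smeval_eq_eval, nsmul_eq_mul] at h2
  have : (n.factorial : ℝ) ≠ 0 := by positivity
  rw [← h2]
  field_simp

theorem Gamma_nat_add_eq_ascPochhammer {s : ℝ} (hs : 0 < s) (n : ℕ) :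
    Gamma (n + s) = (ascPochhammer ℝ n).eval s * Gamma s := by
  induction n with
  | zero => simp
  | succ n ih =>
    rw [ascPochhammer_succ_eval, mul_right_comm, ← ih, ← add_comm (n : ℝ) s]
    push_cast
    rw [add_right_comm, Gamma_add_one (by positivity), mul_comm]

theorem ascPochhammer_eval_bounds {s : ℝ} (hs : 0 < s) (hs1 : s ≤ 1) (n : ℕ) :
    0 < (ascPochhammer ℝ n).eval s ∧ (ascPochhammer ℝ n).eval s ≤ n.factorial := by
  refine ⟨ascPochhammer_pos n s hs, ?_⟩
  induction n with
  | zero => simp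
  | succ n ih =>
    rw [ascPochhammer_succ_eval, Nat.factorial_succ, mul_comm]
    push_cast
    exact mul_le_mul (by linarith) ih (ascPochhammer_pos n s hs).le (by positivity)

theorem hypergeometric_third_eq_tsum :
    ordinaryHypergeometric (1 / 3 : ℝ) (2 / 3 : ℝ) (1 : ℝ) (1 / 2 : ℝ) =
      ∑' n : ℕ, (ascPochhammer ℝ n).eval (1 / 3) / n.factorial *
        ((ascPochhammer ℝ n).eval (2 / 3) / n.factorial) * (1 / 2) ^ n := by
  rw [ordinaryHypergeometric_eq_tsum]
  refine tsum_congr fun n => ?_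
  rw [ascPochhammer_eval_one, smul_eq_mul]
  ring

/-- Substitute v = (1 - t)². Then 1 - v = 2t(1 - t/2), and t and 1 - t/2 carry the same exponent
-1/3, so they merge into a power of 1 - v. -/
theorem integral_euler_half :
    ∫ t in Ioo (0 : ℝ) 1, 1 / (1 - t / 2) ^ (1 / 3 : ℝ) *
      (t ^ (2 / 3 - 1 : ℝ) * (1 - t) ^ (1 / 3 - 1 : ℝ)) =
      2 ^ (1 / 3 : ℝ) / 2 * (Gamma (1 / 6) * Gamma (2 / 3) / Gamma (1 / 6 + 2 / 3)) := by
  rw [← (integral_beta (a := 1 / 6) (b := 2 / 3) (by norm_num) (by norm_num)).2]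
  set f : ℝ → ℝ := fun t => (1 - t) ^ 2 with hf
  have hd : ∀ t ∈ Ioo (0 : ℝ) 1, HasDerivWithinAt f (-(2 * (1 - t))) (Ioo 0 1) t := by
    intro t _
    have h := ((hasDerivAt_id t).const_sub 1).pow 2
    refine (h.congr_deriv ?_).hasDerivWithinAt
    simp
  have hinj : InjOn f (Ioo 0 1) := by
    have : StrictAntiOn f (Ioo 0 1) := by
      intro a ha b hb hab
      have := hb.2
      simp only [hf]
      gcongr
    exact this.injOn
  have himg : f '' Ioo 0 1 = Ioo 0 1 := by
    ext y
    constructor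
    · rintro ⟨t, ⟨h0, h1⟩, rfl⟩
      simp only [hf]
      constructor <;> nlinarith
    · rintro ⟨h0, h1⟩
      refine ⟨1 - √y, ⟨?_, ?_⟩, ?_⟩
      · have := (Real.sqrt_lt' one_pos).2 (by simpa using h1 : y < 1 ^ 2)
        linarith
      · have := Real.sqrt_pos.2 h0
        linarith
      · simp [hf, Real.sq_sqrt h0.le]
  conv_rhs => rw [← himg]
  rw [integral_image_eq_integral_abs_deriv_smul measurableSet_Ioo hd hinj, ← integral_const_mul]
  refine setIntegral_congr_fun measurableSet_Ioo fun t ht => ?_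
  obtain ⟨h0, h1⟩ := ht
  have hs : 0 < 1 - t := by linarith
  have hs2 : 0 < 1 - t / 2 := by linarith
  simp only [smul_eq_mul, hf]
  have e1 : 1 - (1 - t) ^ 2 = 2 * (t * (1 - t / 2)) := by ring
  have e2 : ((1 - t) ^ 2) ^ (1 / 6 - 1 : ℝ) = (1 - t) ^ (1 / 3 - 1 : ℝ) / (1 - t) := by
    rw [← Real.rpow_natCast, ← Real.rpow_mul hs.le, div_eq_mul_inv _ (1 - t),
      show ((2 : ℕ) : ℝ) * (1 / 6 - 1) = (1 / 3 - 1) + (-1) by norm_num, Real.rpow_add hs,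
      Real.rpow_neg_one]
  have e3 : (2 : ℝ) ^ (2 / 3 - 1 : ℝ) = (2 ^ (1 / 3 : ℝ))⁻¹ := by
    rw [← Real.rpow_neg (by norm_num)]
    norm_num
  have e4 : (1 - t / 2) ^ (2 / 3 - 1 : ℝ) = ((1 - t / 2) ^ (1 / 3 : ℝ))⁻¹ := by
    rw [← Real.rpow_neg hs2.le]
    norm_num
  rw [e1, e2, Real.mul_rpow (by norm_num) (by positivity), Real.mul_rpow h0.le hs2.le, e3, e4,
    abs_neg, abs_of_pos (by positivity)]
  have : 0 < (2 : ℝ) ^ (1 / 3 : ℝ) := by positivity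
  have : 0 < (1 - t / 2) ^ (1 / 3 : ℝ) := by positivity
  field_simp

/-- The value at `1/2` of the hypergeometric function of signature three. -/
theorem hypergeometric_third_half :
    (2 : ℝ) ^ (2 / 3 : ℝ) * ordinaryHypergeometric (1 / 3 : ℝ) (2 / 3 : ℝ) (1 : ℝ) (1 / 2 : ℝ) =
      Gamma (1 / 6) / (Gamma (1 / 3) * Gamma (5 / 6)) := by
  set K := Gamma (2 / 3) * Gamma (1 / 3) with hK
  have hK2 : 0 < Gamma (2 / 3 : ℝ) := Gamma_pos_of_pos (by norm_num)
  have hK1 : 0 < Gamma (1 / 3 : ℝ) := Gamma_pos_of_pos (by norm_num)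
  set c : ℕ → ℝ := fun n => (ascPochhammer ℝ n).eval (1 / 3) / n.factorial with hc
  set w : ℝ → ℝ := fun t => t ^ (2 / 3 - 1 : ℝ) * (1 - t) ^ (1 / 3 - 1 : ℝ) with hw
  -- Euler's integral: the binomial series of (1 - t/2)^(-1/3) against a beta weight, integrated
  -- term by term.
  set F : ℕ → ℝ → ℝ := fun n t => c n * (t / 2) ^ n * w t with hF
  have hc0 : ∀ n, 0 ≤ c n := fun n =>
    div_nonneg (ascPochhammer_eval_bounds (by norm_num) (by norm_num) n).1.le (by positivity)
  have hFe : ∀ n, EqOn (fun t : ℝ => c n * (1 / 2) ^ n *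
      (t ^ (n + 2 / 3 - 1 : ℝ) * (1 - t) ^ (1 / 3 - 1 : ℝ))) (F n) (Ioo 0 1) := by
    intro n t ht
    simp only [hF, hw]
    rw [add_sub_assoc, Real.rpow_add ht.1, Real.rpow_natCast]
    ring
  have hbeta : ∀ n : ℕ, _ := fun n =>
    integral_beta (a := n + 2 / 3) (b := 1 / 3) (by positivity) (by norm_num)
  have hFint : ∀ n, IntegrableOn (F n) (Ioo 0 1) := fun n =>
    IntegrableOn.congr_fun ((hbeta n).1.const_mul _) (hFe n) measurableSet_Ioo
  have hFval : ∀ n, ∫ t in Ioo (0 : ℝ) 1, F n t =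
      K * (c n * ((ascPochhammer ℝ n).eval (2 / 3) / n.factorial) * (1 / 2) ^ n) := fun n => by
    rw [← setIntegral_congr_fun measurableSet_Ioo (hFe n), integral_const_mul, (hbeta n).2,
      Gamma_nat_add_eq_ascPochhammer (by norm_num), add_assoc,
      show (2 / 3 + 1 / 3 : ℝ) = 1 by norm_num, Gamma_nat_eq_factorial]
    ring
  have hFnorm : ∀ n, ∫ t in Ioo (0 : ℝ) 1, ‖F n t‖ = ∫ t in Ioo (0 : ℝ) 1, F n t := fun n => by
    refine setIntegral_congr_fun measurableSet_Ioo fun t ht => ?_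
    have := hc0 n
    have := ht.1
    have : 0 < 1 - t := by linarith [ht.2]
    exact Real.norm_of_nonneg (by simp only [hF, hw]; positivity)
  have hsum : Summable fun n => ∫ t in Ioo (0 : ℝ) 1, ‖F n t‖ := by
    simp_rw [hFnorm, hFval]
    refine Summable.mul_left _ (Summable.of_nonneg_of_le (fun n => ?_) (fun n => ?_)
      (summable_geometric_of_lt_one (by norm_num) (by norm_num : (1 / 2 : ℝ) < 1)))
    · have := hc0 n
      have := (ascPochhammer_eval_bounds (s := 2 / 3) (by norm_num) (by norm_num) n).1
      positivity
    · have h1 := ascPochhammer_eval_bounds (s := 1 / 3) (by norm_num) (by norm_num) n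
      have h2 := ascPochhammer_eval_bounds (s := 2 / 3) (by norm_num) (by norm_num) n
      have hn : (0 : ℝ) < n.factorial := by positivity
      refine mul_le_of_le_one_left (by positivity) (mul_le_one₀ ?_ ?_ ?_)
      · exact (div_le_one hn).2 h1.2
      · exact div_nonneg h2.1.le hn.le
      · exact (div_le_one hn).2 h2.2
  have h := integral_tsum_of_summable_integral_norm (μ := volume.restrict (Ioo (0 : ℝ) 1))
    hFint hsum
  simp_rw [hFval, tsum_mul_left] at h
  have hin : ∫ t in Ioo (0 : ℝ) 1, (∑' n, F n t) =
      ∫ t in Ioo (0 : ℝ) 1, 1 / (1 - t / 2) ^ (1 / 3 : ℝ) *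
        (t ^ (2 / 3 - 1 : ℝ) * (1 - t) ^ (1 / 3 - 1 : ℝ)) := by
    refine setIntegral_congr_fun measurableSet_Ioo fun t ht => ?_
    have hb := (hasSum_ascPochhammer_mul_pow (1 / 3) (x := t / 2) (by
      rw [abs_of_pos (by linarith [ht.1])]; linarith [ht.2])).mul_right (w t)
    exact hb.tsum_eq
  rw [hin, integral_euler_half, ← hypergeometric_third_eq_tsum,
    show (1 / 6 + 2 / 3 : ℝ) = 5 / 6 by norm_num] at h
  have e : (2 : ℝ) ^ (2 / 3 : ℝ) * 2 ^ (1 / 3 : ℝ) = 2 := by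
    rw [← Real.rpow_add (by norm_num)]; norm_num
  have hG : 0 < Gamma (5 / 6 : ℝ) := Gamma_pos_of_pos (by norm_num)
  have hK0 : K ≠ 0 := (mul_pos hK2 hK1).ne'
  refine mul_left_cancel₀ hK0 ?_
  calc K * (2 ^ (2 / 3 : ℝ) * ordinaryHypergeometric (1 / 3 : ℝ) (2 / 3 : ℝ) (1 : ℝ) (1 / 2 : ℝ)) =
      (2 ^ (2 / 3 : ℝ) * 2 ^ (1 / 3 : ℝ)) / 2 * (Gamma (1 / 6) * Gamma (2 / 3) / Gamma (5 / 6)) := by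
        rw [mul_left_comm, h]
        ring
    _ = _ := by
      rw [e, hK]
      field_simp

end

/-! ### Extremal temperatures and conclusion. -/

theorem tsum_hexGaussian_pos : 0 < ∑' n : ℤ × ℤ, hexGaussian n.1 n.2 :=
  summable_hexGaussian_int.tsum_pos (fun _ => (hexGaussian_pos _ _).le) 0 (hexGaussian_pos _ _)

theorem isLeast_minTemperature_hexLattice :
    IsLeast (Set.range fun z : Fin 2 → ℝ => (heatKernel hexLattice 1 z).re)
      (minTemperature hexLattice 1) ∧
    minTemperature hexLattice 1 = (heatKernel hexLattice 1 ![1 / 3, 1 / 3]).re := by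
  have h : IsLeast (Set.range fun z : Fin 2 → ℝ => (heatKernel hexLattice 1 z).re)
      (heatKernel hexLattice 1 ![1 / 3, 1 / 3]).re :=
    ⟨⟨_, rfl⟩, by rintro _ ⟨z, rfl⟩; exact le_re_heatKernel_hexLattice z⟩
  have e : minTemperature hexLattice 1 = _ := h.csInf_eq
  rw [e]
  exact ⟨h, rfl⟩

theorem isGreatest_maxTemperature_hexLattice :
    IsGreatest (Set.range fun z : Fin 2 → ℝ => (heatKernel hexLattice 1 z).re)
      (maxTemperature hexLattice 1) ∧
    maxTemperature hexLattice 1 = ∑' n : ℤ × ℤ, hexGaussian n.1 n.2 := by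
  have h : IsGreatest (Set.range fun z : Fin 2 → ℝ => (heatKernel hexLattice 1 z).re)
      (∑' n : ℤ × ℤ, hexGaussian n.1 n.2) := by
    refine ⟨⟨0, ?_⟩, by rintro _ ⟨z, rfl⟩; exact re_heatKernel_hexLattice_le z⟩
    simp only [heatKernel_hexLattice_zero, Complex.ofReal_re]
  have e : maxTemperature hexLattice 1 = _ := h.csSup_eq
  rw [e]
  exact ⟨h, rfl⟩

theorem heatKernel_hexLattice_im (z : Fin 2 → ℝ) : (heatKernel hexLattice 1 z).im = 0 := by
  rw [heatKernel_hexLattice_eq_tsum, Complex.ofReal_im]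

theorem minTemperature_hexLattice_eq :
    minTemperature hexLattice 1 =
      (2 : ℝ) ^ (-(1 / 3) : ℝ) * ∑' n : ℤ × ℤ, hexGaussian n.1 n.2 := by
  have h := pow_three_tsum_hexGaussian_eq_two_mul
  rw [isLeast_minTemperature_hexLattice.2, heatKernel_hexLattice_eq_tsum, Complex.ofReal_re]
  simp only [Matrix.cons_val_zero, Matrix.cons_val_one]
  have hC : 0 ≤ ∑' n : ℤ × ℤ, hexGaussian (n.1 + 1 / 3) (n.2 + 1 / 3) :=
    tsum_nonneg fun _ => (hexGaussian_pos _ _).le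
  have hA := tsum_hexGaussian_pos
  have h2 : ((2 : ℝ) ^ (-(1 / 3) : ℝ)) ^ 3 = 1 / 2 := by
    rw [← Real.rpow_natCast, ← Real.rpow_mul (by norm_num)]
    norm_num
  refine (pow_left_inj₀ hC (by positivity) three_ne_zero).1 ?_
  rw [mul_pow, h2, h]
  ring

theorem zpow_eq_pow_hexNorm (q : ℝ) (n : ℤ × ℤ) :
    q ^ (n.1 ^ 2 + n.1 * n.2 + n.2 ^ 2) = q ^ hexNorm n := by
  rw [← hexNorm_cast_int, zpow_natCast]

theorem cubicThetaA_hexNome :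
    cubicThetaA (Real.exp (-(2 * Real.pi / √3))) = ∑' n : ℤ × ℤ, hexGaussian n.1 n.2 := by
  refine tsum_congr fun n => ?_
  rw [zpow_eq_pow_hexNorm, hexGaussian_int, hexNome]

theorem cubicThetaB_hexNome :
    cubicThetaB (Real.exp (-(2 * Real.pi / √3))) = heatKernel hexLattice 1 ![1 / 3, 1 / 3] := by
  rw [heatKernel_hexLattice_third]
  refine tsum_congr fun n => ?_
  rw [hexGaussian_int, hexNome, ← hexNorm_cast_int, zpow_natCast]
  push_cast
  congr 2
  ring

theorem two_mul_minTemperature_hexLattice :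
    2 * minTemperature hexLattice 1 =
      Real.Gamma (1 / 6) / (Real.Gamma (1 / 3) * Real.Gamma (5 / 6)) := by
  have hpi := Real.pi_pos
  have hA := tsum_hexGaussian_pos
  have hs := tsum_hexGaussian_sq
  have hT := thetaThree_sqrt_three_sq_mul
  -- Legendre duplication trades √π Γ(2/3) for Γ(1/3) Γ(5/6).
  have hd := Real.Gamma_mul_Gamma_add_half (1 / 3)
  have h3 : √3 ^ 2 = (3 : ℝ) := Real.sq_sqrt (by norm_num)
  have g6 : 0 < Real.Gamma (1 / 6) := Real.Gamma_pos_of_pos (by norm_num)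
  have g23 : 0 < Real.Gamma (2 / 3) := Real.Gamma_pos_of_pos (by norm_num)
  have hpi2 : √Real.pi ^ 2 = Real.pi := Real.sq_sqrt hpi.le
  have hp : 0 < √Real.pi := Real.sqrt_pos.2 hpi
  have hA1 : ∑' n : ℤ × ℤ, hexGaussian n.1 n.2 = √3 * √√3 / 2 * thetaThree √3 ^ 2 := by
    refine (pow_left_inj₀ hA.le (by positivity) two_ne_zero).1 ?_
    rw [hs, mul_pow, div_pow, mul_pow, sqrt_sqrt_three_sq, h3]
    ring
  have hA2 : ∑' n : ℤ × ℤ, hexGaussian n.1 n.2 =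
      Real.Gamma (1 / 6) / (2 * √Real.pi * Real.Gamma (2 / 3)) := by
    have hT2 : thetaThree √3 ^ 2 = √√3 / (3 * Real.pi) *
        (Real.Gamma (1 / 6) * √Real.pi / Real.Gamma (2 / 3)) := by
      field_simp at hT ⊢
      linarith
    rw [hA1, hT2]
    calc _ = √3 * √√3 ^ 2 / (6 * Real.pi) *
          (Real.Gamma (1 / 6) * √Real.pi / Real.Gamma (2 / 3)) := by ring
      _ = 3 / (6 * √Real.pi ^ 2) * (Real.Gamma (1 / 6) * √Real.pi / Real.Gamma (2 / 3)) := by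
        rw [sqrt_sqrt_three_sq, hpi2, ← sq, h3]
      _ = _ := by field_simp; norm_num
  rw [show (1 / 3 + 1 / 2 : ℝ) = 5 / 6 by norm_num, show (2 * (1 / 3) : ℝ) = 2 / 3 by norm_num,
    show (1 - 2 / 3 : ℝ) = 1 + -(2 / 3) by norm_num, Real.rpow_add (by norm_num), Real.rpow_one]
    at hd
  have h2 : (2 : ℝ) ^ (-(1 / 3) : ℝ) * 2 ^ (-(2 / 3) : ℝ) = 1 / 2 := by
    rw [← Real.rpow_add (by norm_num)]
    norm_num
  have hx : 0 < (2 : ℝ) ^ (-(2 / 3) : ℝ) := by positivity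
  have hy : (2 : ℝ) ^ (-(1 / 3) : ℝ) = 1 / (2 * 2 ^ (-(2 / 3) : ℝ)) := by
    field_simp
    linarith
  rw [minTemperature_hexLattice_eq, hA2, hd, hy]
  field_simp

theorem mainTheorem5 :
    -- the kernel at time one: its series converges, is real, and is the periodized Gaussian
    (∀ z : Fin 2 → ℝ,
      HasSum (heatTerm hexLattice 1 z) (heatKernel hexLattice 1 z) ∧
      (heatKernel hexLattice 1 z).im = 0 ∧
      HasSum (fun n : ℤ × ℤ => Real.exp (-Real.pi * sqLength hexLattice (intVec n + z)))
        (heatKernel hexLattice 1 z).re) ∧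
    -- the minimum is attained at (1/3, 1/3), the maximum at the origin
    IsLeast (Set.range fun z : Fin 2 → ℝ => (heatKernel hexLattice 1 z).re)
      (minTemperature hexLattice 1) ∧
    heatKernel hexLattice 1 ![1 / 3, 1 / 3] = (minTemperature hexLattice 1 : ℂ) ∧
    IsGreatest (Set.range fun z : Fin 2 → ℝ => (heatKernel hexLattice 1 z).re)
      (maxTemperature hexLattice 1) ∧
    heatKernel hexLattice 1 0 = (maxTemperature hexLattice 1 : ℂ) ∧
    -- the two extremal temperatures as cubic theta values, and their ratio
    (minTemperature hexLattice 1 : ℂ) =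
      cubicThetaB (Real.exp (-(2 * Real.pi / Real.sqrt 3))) ∧
    maxTemperature hexLattice 1 =
      cubicThetaA (Real.exp (-(2 * Real.pi / Real.sqrt 3))) ∧
    minTemperature hexLattice 1 / maxTemperature hexLattice 1 = (2 : ℝ) ^ (-(1 / 3) : ℝ) ∧
    -- twice the lowest temperature
    2 * minTemperature hexLattice 1 =
      (2 : ℝ) ^ (2 / 3 : ℝ) * ordinaryHypergeometric (1 / 3 : ℝ) (2 / 3 : ℝ) (1 : ℝ) (1 / 2 : ℝ) ∧
    (2 : ℝ) ^ (2 / 3 : ℝ) * ordinaryHypergeometric (1 / 3 : ℝ) (2 / 3 : ℝ) (1 : ℝ) (1 / 2 : ℝ) =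
      Real.Gamma (1 / 6) / (Real.Gamma (1 / 3) * Real.Gamma (5 / 6)) ∧
    2 * minTemperature hexLattice 1 = rademacherBound⁻¹ := by
  obtain ⟨hmin, hmineq⟩ := isLeast_minTemperature_hexLattice
  obtain ⟨hmax, hmaxeq⟩ := isGreatest_maxTemperature_hexLattice
  have hthird : heatKernel hexLattice 1 ![1 / 3, 1 / 3] = (minTemperature hexLattice 1 : ℂ) := by
    rw [hmineq]
    exact Complex.ext (by simp) (by simp [heatKernel_hexLattice_im])
  refine ⟨fun z => ⟨(summable_heatTerm_hexLattice z).hasSum, heatKernel_hexLattice_im z, ?_⟩, hmin,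
    hthird, hmax, ?_, ?_, ?_, ?_, ?_, hypergeometric_third_half, ?_⟩
  · simp_rw [exp_sqLength_hexLattice, heatKernel_hexLattice_eq_tsum, Complex.ofReal_re]
    exact (summable_hexGaussian _ _).hasSum
  · rw [heatKernel_hexLattice_zero, hmaxeq]
  · rw [cubicThetaB_hexNome, hthird]
  · rw [cubicThetaA_hexNome, hmaxeq]
  · rw [minTemperature_hexLattice_eq, hmaxeq, mul_div_cancel_right₀ _ tsum_hexGaussian_pos.ne']
  · rw [hypergeometric_third_half, two_mul_minTemperature_hexLattice]
  · rw [two_mul_minTemperature_hexLattice, rademacherBound, inv_div]
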